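/- \textbf{Definitions.} Let $S$ be a semigroup, and let $S^1$ be $S$ with an identity adjoined. For $a,b\in S$ write $a\,\mathcal R^*\,b$ if for all $x,y\in S^1$: $xa=ya \iff xb=yb$; dually, $a\,\mathcal L^*\,b$ if for all $x,y\in S^1$: $ax=ay\iff bx=by$. $S$ is \emph{left adequate} [\emph{right adequate}] if its idempotents commute and every $\mathcal R^*$-class [$\mathcal L^*$-class] contains an idempotent; this idempotent is then unique, and $x^+$ [$x^*$] denotes the idempotent in the class of $x$. Left [right] adequate semigroups are considered as $(2,1)$-algebras under multiplication and $x\mapsto x^+$ [$x\mapsto x^*$], and their morphisms are the maps preserving both operations. A left [right] adequate semigroup $F$ is \emph{free on} a subset $B\subseteq F$ if every function from $B$ to a left [right] adequate semigroup $N$ extends uniquely to a morphism $F\to N$. Let $\Sigma$ be a set. A \emph{$\Sigma$-tree} is a finite directed graph with edges labelled by elements of $\Sigma$, whose underlying undirected graph is a tree, with a distinguished start vertex and end vertex such that there is a (possibly empty) directed path from the start to the end. It is \emph{non-trivial} if it has more than one vertex. A \emph{morphism} of $\Sigma$-trees maps vertices to vertices and edges to edges, preserving incidence, direction and labels of edges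 and the start and end vertices; an isomorphism is a bijective morphism. A \emph{retraction} of $X$ is an idempotent morphism $X\to X$; its image is a \emph{retract} of $X$; $X$ is \emph{pruned} if its only retraction is the identity. Every tree $X$ has a pruned retract $\overline X$, unique up to isomorphism. $X\times Y$ is obtained by gluing $X$ and $Y$, identifying the end of $X$ with the start of $Y$; $X^{(+)}$ is $X$ with its end vertex moved to its start vertex; $X^{(*)}$ is $X$ with its start vertex moved to its end vertex. The \emph{pruned operations} are $XY=\overline{X\times Y}$, $X^+=\overline{X^{(+)}}$, $X^*=\overline{X^{(*)}}$. The \emph{base tree} of $a\in\Sigma$ has a single edge, labelled $a$, from the start vertex to a distinct end vertex; it is identified with $a$. A tree is \emph{left adequate} [\emph{right adequate}] if for every vertex $v$ there is a directed path from the start vertex to $v$ [from $v$ to the end vertex]. Let $LT(\Sigma)$ [$RT(\Sigma)$] be the set of isomorphism types of non-trivial pruned left adequate [right adequate] $\Sigma$-trees, with pruned multiplication and pruned $+$ [pruned $*$]. \textbf{Theorem.} Let $\Sigma$ be any set. Then distinct letters have distinct base trees in $LT(\Sigma)$ [$RT(\Sigma)$], and $LT(\Sigma)$ [$RT(\Sigma)$],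 with the above operations, is a left adequate [right adequate] semigroup which is free on the set $\Sigma$ of base trees. -/

import Mathlib

universe u v w

namespace AdequateTrees

/-! ## Left and right adequate semigroups as `(2,1)`-algebras -/

/-- An algebra of signature `(2,1)`: a multiplication and one unary operation (no laws). -/
class Algebra21 (S : Type u) extends Mul S where
  unary : S → S

/-- Morphisms of `(2,1)`-algebras. -/
structure IsMorphism {S : Type u} {T : Type v} [Algebra21 S] [Algebra21 T] (φ : S → T) :
    Prop where
  map_mul : ∀ x y, φ (x * y) = φ x * φ y
  map_unary : ∀ x, φ (Algebra21.unary x) = Algebra21.unary (φ x)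

/-- The relation `R*`: for all `x, y ∈ S¹`, `xa = ya` if and only if `xb = yb`.
(If `S` already has an identity, adjoining a further one does not change the relation.) -/
def RStar {S : Type u} [Mul S] (a b : S) : Prop :=
  ∀ x y : WithOne S, x * (a : WithOne S) = y * (a : WithOne S) ↔
    x * (b : WithOne S) = y * (b : WithOne S)

/-- The relation `L*`: for all `x, y ∈ S¹`, `ax = ay` if and only if `bx = by`. -/
def LStar {S : Type u} [Mul S] (a b : S) : Prop :=
  ∀ x y : WithOne S, (a : WithOne S) * x = (a : WithOne S) * y ↔
    (b : WithOne S) * x = (b : WithOne S) * y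

/-- A `(2,1)`-algebra is a left adequate semigroup: it is a semigroup, its idempotents commute,
every `R*`-class contains an idempotent, and the unary operation `x ↦ x⁺` takes `x` to the
(then unique) idempotent in its `R*`-class. -/
structure IsLeftAdequate (S : Type u) [Algebra21 S] : Prop where
  mul_assoc : ∀ x y z : S, x * y * z = x * (y * z)
  idem_comm : ∀ e f : S, IsIdempotentElem e → IsIdempotentElem f → e * f = f * e
  unary_idem : ∀ x : S, IsIdempotentElem (Algebra21.unary x)
  unary_rStar : ∀ x : S, RStar x (Algebra21.unary x)

/-- A `(2,1)`-algebra is a right adequate semigroup: it is a semigroup, its idempotents commute,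
every `L*`-class contains an idempotent, and the unary operation `x ↦ x*` takes `x` to the
(then unique) idempotent in its `L*`-class. -/
structure IsRightAdequate (S : Type u) [Algebra21 S] : Prop where
  mul_assoc : ∀ x y z : S, x * y * z = x * (y * z)
  idem_comm : ∀ e f : S, IsIdempotentElem e → IsIdempotentElem f → e * f = f * e
  unary_idem : ∀ x : S, IsIdempotentElem (Algebra21.unary x)
  unary_lStar : ∀ x : S, LStar x (Algebra21.unary x)

/-- `F` is a free left adequate semigroup, free on the subset `B`: it is a left adequate
semigroup, and every function from `B` to a left adequate semigroup `N` extends uniquely to a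
`(2,1)`-morphism from `F` to `N`. -/
structure IsFreeLeftAdequateOn (F : Type u) [Algebra21 F] (B : Set F) : Prop where
  isLeftAdequate : IsLeftAdequate F
  existsUnique_extension : ∀ (N : Type w) [Algebra21 N], IsLeftAdequate N → ∀ χ : B → N,
    ∃! φ : F → N, IsMorphism φ ∧ ∀ b : B, φ b = χ b

/-- `F` is a free right adequate semigroup, free on the subset `B`. -/
structure IsFreeRightAdequateOn (F : Type u) [Algebra21 F] (B : Set F) : Prop where
  isRightAdequate : IsRightAdequate F
  existsUnique_extension : ∀ (N : Type w) [Algebra21 N], IsRightAdequate N → ∀ χ : B → N,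
    ∃! φ : F → N, IsMorphism φ ∧ ∀ b : B, φ b = χ b

/-! ## Labelled directed trees -/

/-- A (finite) `A`-tree: a directed graph with edges labelled by elements of `A`, whose
underlying undirected graph is a tree, with a start vertex and an end vertex (`finish`) such that
there is a directed path from the start vertex to the end vertex.

`Edge p a q` says that there is an edge from `p` to `q` with label `a`. In a tree there is at most
one edge between two given vertices (`edge_label`, `edge_dir`) and there are no loops (`edge_dir`
with `p = q`), so that an edge is determined by its two ends. -/
structure STree (A : Type u) where
  V : Type
  finite : Finite V
  Edge : V → A → V → Prop
  start : V
  finish : V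
  edge_label : ∀ {p q a b}, Edge p a q → Edge p b q → a = b
  edge_dir : ∀ {p q a b}, Edge p a q → ¬ Edge q b p
  isTree : (SimpleGraph.fromRel (fun p q => ∃ a, Edge p a q)).IsTree
  path : Relation.ReflTransGen (fun p q => ∃ a, Edge p a q) start finish

namespace STree

variable {A : Type u}

/-- There is a directed edge from `p` to `q`. -/
def Step (X : STree A) (p q : X.V) : Prop := ∃ a, X.Edge p a q

/-- There is a (possibly empty) directed path from `p` to `q`. -/
def Path (X : STree A) (p q : X.V) : Prop := Relation.ReflTransGen X.Step p q

/-- The underlying undirected graph. -/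
def graph (X : STree A) : SimpleGraph X.V := SimpleGraph.fromRel X.Step

theorem step_ne (X : STree A) {p q : X.V} (h : X.Step p q) : p ≠ q := by
  rintro rfl
  obtain ⟨a, ha⟩ := h
  exact X.edge_dir ha ha

theorem graph_adj (X : STree A) {p q : X.V} : X.graph.Adj p q ↔ X.Step p q ∨ X.Step q p := by
  simp only [graph, SimpleGraph.fromRel_adj]
  constructor
  · exact fun h => h.2
  · intro h
    refine ⟨?_, h⟩
    rcases h with h | h
    · exact X.step_ne h
    · exact (X.step_ne h).symm

/-- The tree is non-trivial: it has more than one vertex. -/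
def IsNontrivial (X : STree A) : Prop := Nontrivial X.V

/-- Every vertex can be reached by a directed path from the start vertex. -/
def IsLeftAdequate (X : STree A) : Prop := ∀ p : X.V, X.Path X.start p

/-- From every vertex the end vertex can be reached by a directed path. -/
def IsRightAdequate (X : STree A) : Prop := ∀ p : X.V, X.Path p X.finish

/-- A morphism of `A`-trees. As edges are determined by their ends, a morphism is
determined by its action on the vertices. -/
@[ext] structure Hom (X Y : STree A) where
  toFun : X.V → Y.V
  map_edge : ∀ {p a q}, X.Edge p a q → Y.Edge (toFun p) a (toFun q)
  map_start : toFun X.start = Y.start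
  map_finish : toFun X.finish = Y.finish

namespace Hom

/-- Composition of morphisms. -/
def comp {X Y Z : STree A} (g : Hom Y Z) (f : Hom X Y) : Hom X Z where
  toFun := fun p => g.toFun (f.toFun p)
  map_edge := fun h => g.map_edge (f.map_edge h)
  map_start := by rw [f.map_start, g.map_start]
  map_finish := by rw [f.map_finish, g.map_finish]

theorem map_step {X Y : STree A} (f : Hom X Y) {p q : X.V} (h : X.Step p q) :
    Y.Step (f.toFun p) (f.toFun q) := by
  obtain ⟨a, ha⟩ := h
  exact ⟨a, f.map_edge ha⟩

theorem map_path {X Y : STree A} (f : Hom X Y) {p q : X.V} (h : X.Path p q) :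
    Y.Path (f.toFun p) (f.toFun q) :=
  Relation.ReflTransGen.lift f.toFun (fun _ _ h => f.map_step h) _ _ h

end Hom

/-- A retraction of `X`: an idempotent morphism from `X` to itself. -/
def IsRetraction {X : STree A} (π : Hom X X) : Prop :=
  ∀ p, π.toFun (π.toFun p) = π.toFun p

/-- A tree is pruned if its only retraction is the identity. -/
def IsPruned (X : STree A) : Prop :=
  ∀ π : Hom X X, IsRetraction π → ∀ p, π.toFun p = p

/-- Isomorphism of `A`-trees: a bijection of the vertices inducing a label- and
direction-preserving bijection of the edges and preserving start and end. -/
def Iso (X Y : STree A) : Prop :=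
  ∃ f : X.V ≃ Y.V, (∀ p a q, X.Edge p a q ↔ Y.Edge (f p) a (f q)) ∧
    f X.start = Y.start ∧ f X.finish = Y.finish

theorem Iso.refl (X : STree A) : Iso X X := ⟨Equiv.refl _, fun _ _ _ => Iff.rfl, rfl, rfl⟩

theorem Iso.symm {X Y : STree A} (h : Iso X Y) : Iso Y X := by
  obtain ⟨f, h1, h2, h3⟩ := h
  refine ⟨f.symm, fun p a q => ?_, ?_, ?_⟩
  · rw [h1]; simp
  · rw [← h2]; simp
  · rw [← h3]; simp

theorem Iso.trans {X Y Z : STree A} (h : Iso X Y) (h' : Iso Y Z) : Iso X Z := by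
  obtain ⟨f, h1, h2, h3⟩ := h
  obtain ⟨g, k1, k2, k3⟩ := h'
  refine ⟨f.trans g, fun p a q => ?_, ?_, ?_⟩
  · rw [h1, k1]; rfl
  · simp [h2, k2]
  · simp [h3, k3]

theorem Iso.exists_hom {X Y : STree A} (h : Iso X Y) :
    ∃ (f : Hom X Y) (g : Hom Y X), (∀ p, g.toFun (f.toFun p) = p) ∧
      ∀ q, f.toFun (g.toFun q) = q := by
  obtain ⟨f, h1, h2, h3⟩ := h
  refine ⟨⟨f, fun e => (h1 _ _ _).1 e, h2, h3⟩,
    ⟨f.symm, fun e => (h1 _ _ _).2 (by simpa using e), ?_, ?_⟩, fun p => by simp, fun q => by simp⟩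
  · rw [← h2]; simp
  · rw [← h3]; simp

theorem iso_of_hom {X Y : STree A} (f : Hom X Y) (g : Hom Y X)
    (h : ∀ p, g.toFun (f.toFun p) = p) (h' : ∀ q, f.toFun (g.toFun q) = q) : Iso X Y := by
  refine ⟨⟨f.toFun, g.toFun, h, h'⟩, fun p a q => ⟨f.map_edge, fun e => ?_⟩,
    f.map_start, f.map_finish⟩
  have := g.map_edge e
  simpa [h] using this

/-! ### Retracts and pruning -/

/-- The image of a retraction, as a subtree. -/
def image {X : STree A} (π : Hom X X) (hπ : IsRetraction π) : STree A where
  V := Set.range π.toFun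
  finite := by
    have := X.finite
    infer_instance
  Edge := fun p a q => X.Edge p.1 a q.1
  start := ⟨X.start, X.start, π.map_start⟩
  finish := ⟨X.finish, X.finish, π.map_finish⟩
  edge_label := fun h h' => X.edge_label h h'
  edge_dir := fun h h' => X.edge_dir h h'
  isTree := by
    have hX := X.isTree
    have hfix : ∀ p : Set.range π.toFun, π.toFun p.1 = p.1 := by
      rintro ⟨_, q, rfl⟩
      exact hπ q
    constructor
    · have : Nonempty (Set.range π.toFun) := ⟨⟨X.start, X.start, π.map_start⟩⟩
      refine ⟨fun p q => ?_⟩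
      let F : X.graph →g (SimpleGraph.fromRel
          (fun p q : Set.range π.toFun => ∃ a, X.Edge p.1 a q.1)) :=
        ⟨fun p => ⟨π.toFun p, p, rfl⟩, by
          intro p q h
          rw [X.graph_adj] at h
          rw [SimpleGraph.fromRel_adj]
          rcases h with h | h
          · refine ⟨fun e => X.step_ne (π.map_step h) (congrArg Subtype.val e),
              Or.inl (π.map_step h)⟩
          · refine ⟨fun e => X.step_ne (π.map_step h) (congrArg Subtype.val e).symm,
              Or.inr (π.map_step h)⟩⟩
      have h := (hX.1.preconnected p.1 q.1).map F
      have e : ∀ p : Set.range π.toFun, F p.1 = p := fun p => Subtype.ext (hfix p)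
      rw [e, e] at h
      exact h
    · refine SimpleGraph.IsAcyclic.comap (G' := X.graph) ⟨Subtype.val, ?_⟩
        Subtype.val_injective hX.2
      intro p q h
      rw [SimpleGraph.fromRel_adj] at h
      exact X.graph_adj.2 h.2
  path := by
    have h := Relation.ReflTransGen.lift (r := X.Step)
      (p := fun p q : Set.range π.toFun => ∃ a, X.Edge p.1 a q.1)
      (fun p => (⟨π.toFun p, p, rfl⟩ : Set.range π.toFun))
      (fun _ _ h => π.map_step h) _ _ X.path
    have e1 : (⟨π.toFun X.start, X.start, rfl⟩ : Set.range π.toFun) =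
      ⟨X.start, X.start, π.map_start⟩ := Subtype.ext π.map_start
    have e2 : (⟨π.toFun X.finish, X.finish, rfl⟩ : Set.range π.toFun) =
      ⟨X.finish, X.finish, π.map_finish⟩ := Subtype.ext π.map_finish
    simp only [Function.onFun] at h
    rw [e1, e2] at h
    exact h

/-- `Y` is (isomorphic to) a retract of `X`. -/
def IsRetractOf (Y X : STree A) : Prop :=
  ∃ (π : Hom X X) (hπ : IsRetraction π), Iso Y (image π hπ)

theorem isRetractOf_iff {Y X : STree A} :
    IsRetractOf Y X ↔ ∃ (r : Hom X Y) (i : Hom Y X), ∀ p, r.toFun (i.toFun p) = p := by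
  constructor
  · rintro ⟨π, hπ, h⟩
    obtain ⟨f, g, hgf, -⟩ := h.exists_hom
    let r : Hom X (image π hπ) := ⟨fun p => ⟨π.toFun p, p, rfl⟩, fun e => π.map_edge e,
      Subtype.ext π.map_start, Subtype.ext π.map_finish⟩
    let i : Hom (image π hπ) X := ⟨Subtype.val, fun e => e, rfl, rfl⟩
    refine ⟨g.comp r, i.comp f, fun p => ?_⟩
    have : r.toFun (i.toFun (f.toFun p)) = f.toFun p := by
      obtain ⟨q, hq⟩ := (f.toFun p).2
      apply Subtype.ext
      change π.toFun (f.toFun p).1 = (f.toFun p).1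
      rw [← hq, hπ]
    change g.toFun (r.toFun (i.toFun (f.toFun p))) = p
    rw [this, hgf]
  · rintro ⟨r, i, h⟩
    refine ⟨i.comp r, fun p => ?_, ?_⟩
    · change i.toFun (r.toFun (i.toFun (r.toFun p))) = i.toFun (r.toFun p)
      rw [h]
    · refine iso_of_hom
        ⟨fun p => ⟨i.toFun p, i.toFun p, ?_⟩, fun e => i.map_edge e, ?_, ?_⟩
        ⟨fun p => r.toFun p.1, fun e => r.map_edge e, r.map_start, r.map_finish⟩ ?_ ?_
      · change i.toFun (r.toFun (i.toFun p)) = i.toFun p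
        rw [h]
      · exact Subtype.ext i.map_start
      · exact Subtype.ext i.map_finish
      · exact h
      · rintro ⟨_, q, rfl⟩
        apply Subtype.ext
        change i.toFun (r.toFun (i.toFun (r.toFun q))) = i.toFun (r.toFun q)
        rw [h]

theorem IsRetractOf.of_iso_right {Y X X' : STree A} (h : IsRetractOf Y X) (e : Iso X X') :
    IsRetractOf Y X' := by
  rw [isRetractOf_iff] at h ⊢
  obtain ⟨r, i, h⟩ := h
  obtain ⟨f, g, hgf, -⟩ := e.exists_hom
  refine ⟨r.comp g, f.comp i, fun p => ?_⟩
  change r.toFun (g.toFun (f.toFun (i.toFun p))) = p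
  rw [hgf, h]

theorem IsRetractOf.trans {X Y Z : STree A} (h : IsRetractOf Z Y) (h' : IsRetractOf Y X) :
    IsRetractOf Z X := by
  rw [isRetractOf_iff] at h h' ⊢
  obtain ⟨r, i, h⟩ := h
  obtain ⟨r', i', h'⟩ := h'
  refine ⟨r.comp r', i'.comp i, fun p => ?_⟩
  change r.toFun (r'.toFun (i'.toFun (i.toFun p))) = p
  rw [h', h]

/-- Every tree has a pruned retract. -/
theorem exists_pruned_retract (X : STree A) : ∃ Y : STree A, IsPruned Y ∧ IsRetractOf Y X := by
  induction hn : Nat.card X.V using Nat.strong_induction_on generalizing X with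
  | _ n ih =>
    by_cases hX : IsPruned X
    · refine ⟨X, hX, isRetractOf_iff.2 ⟨⟨id, fun e => e, rfl, rfl⟩, ⟨id, fun e => e, rfl, rfl⟩, fun _ => rfl⟩⟩
    · unfold IsPruned at hX
      push Not at hX
      obtain ⟨π, hπ, p, hp⟩ := hX
      have := X.finite
      have hlt : Nat.card (image π hπ).V < n := by
        rw [← hn]
        change Nat.card (Set.range π.toFun) < _
        rw [Nat.card_coe_set_eq, ← Set.ncard_univ]
        refine Set.ncard_lt_ncard ?_ Set.finite_univ
        refine ⟨Set.subset_univ _, fun h => ?_⟩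
        obtain ⟨q, hq⟩ := h (Set.mem_univ p)
        apply hp
        rw [← hq, hπ]
      obtain ⟨Y, hY, hY'⟩ := ih _ hlt _ rfl
      exact ⟨Y, hY, hY'.trans ⟨π, hπ, Iso.refl _⟩⟩

/-- An endomorphism of a pruned tree has an inverse which is a morphism. -/
theorem IsPruned.exists_inverse {X : STree A} (hX : IsPruned X) (f : Hom X X) :
    ∃ g : Hom X X, (∀ p, g.toFun (f.toFun p) = p) ∧ ∀ p, f.toFun (g.toFun p) = p := by
  have := X.finite
  let it : ℕ → Hom X X := fun n => ⟨f.toFun^[n],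
    fun {p a q} h => by
      induction n with
      | zero => exact h
      | succ n ih =>
        rw [Function.iterate_succ_apply', Function.iterate_succ_apply']
        exact f.map_edge ih,
    Function.iterate_fixed f.map_start n, Function.iterate_fixed f.map_finish n⟩
  have hfin : Finite (X.V → X.V) := inferInstance
  obtain ⟨m, n, hmn, he⟩ : ∃ m n : ℕ, m < n ∧ f.toFun^[m] = f.toFun^[n] := by
    obtain ⟨m, n, hne, he⟩ := Finite.exists_ne_map_eq_of_infinite (fun n : ℕ => f.toFun^[n])
    rcases lt_or_gt_of_ne hne with h | h
    · exact ⟨m, n, h, he⟩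
    · exact ⟨n, m, h, he.symm⟩
  obtain ⟨d, rfl⟩ : ∃ d, n = m + (d + 1) := ⟨n - m - 1, by omega⟩
  have hper : ∀ k j, f.toFun^[m + j + k * (d + 1)] = f.toFun^[m + j] := by
    intro k
    induction k with
    | zero => intro j; simp
    | succ k ih =>
      intro j
      have e1 : m + j + (k + 1) * (d + 1) = (j + k * (d + 1)) + (m + (d + 1)) := by ring
      have e2 : m + j + k * (d + 1) = (j + k * (d + 1)) + m := by ring
      rw [e1, Function.iterate_add, ← he, ← Function.iterate_add, ← e2, ih]
  -- the power with exponent `(m + 1) * (d + 1)` is idempotent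
  have hid : IsRetraction (it ((m + 1) * (d + 1))) := by
    intro p
    change f.toFun^[(m + 1) * (d + 1)] (f.toFun^[(m + 1) * (d + 1)] p) =
      f.toFun^[(m + 1) * (d + 1)] p
    rw [← Function.iterate_add_apply]
    have hj : (m + 1) * (d + 1) = m + (m * d + d + 1) := by ring
    have h := hper (m + 1) (m * d + d + 1)
    rw [← hj] at h
    rw [h]
  have hone := hX _ hid
  have hs : (m + 1) * (d + 1) = (m * d + m + d) + 1 := by ring
  refine ⟨it (m * d + m + d), fun p => ?_, fun p => ?_⟩
  · have h := hone p
    change f.toFun^[(m + 1) * (d + 1)] p = p at h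
    rwa [hs, Function.iterate_succ_apply] at h
  · have h := hone p
    change f.toFun^[(m + 1) * (d + 1)] p = p at h
    rwa [hs, Function.iterate_succ_apply'] at h

/-- Confluence of retracts: pruned retracts of a tree are isomorphic. -/
theorem pruned_retract_unique {X Y Z : STree A} (hY : IsPruned Y) (hZ : IsPruned Z)
    (hYX : IsRetractOf Y X) (hZX : IsRetractOf Z X) : Iso Y Z := by
  obtain ⟨r, i, -⟩ := isRetractOf_iff.1 hYX
  obtain ⟨r', i', -⟩ := isRetractOf_iff.1 hZX
  let f : Hom Y Z := r'.comp i
  let g : Hom Z Y := r.comp i'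
  obtain ⟨a, ha, -⟩ := hY.exists_inverse (g.comp f)
  obtain ⟨b, -, hb⟩ := hZ.exists_inverse (f.comp g)
  have h1 : ∀ p, (a.comp g).toFun (f.toFun p) = p := ha
  have h2 : ∀ q, f.toFun ((g.comp b).toFun q) = q := hb
  refine iso_of_hom f (a.comp g) h1 fun q => ?_
  rw [← h2 q, h1]

/-! ### Unpruned operations -/

/-- The tree obtained by gluing: the end vertex of `X` is identified with the start vertex of `Y`,
all other vertices and all edges being kept distinct. A vertex `p` of `X` is represented by the
pair `(p, start of Y)`, a vertex `q` of `Y` by the pair `(end of X, q)`. -/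
def prod (X Y : STree A) : STree A where
  V := {p : X.V × Y.V // p.1 = X.finish ∨ p.2 = Y.start}
  finite := by
    have := X.finite
    have := Y.finite
    infer_instance
  Edge := fun p a q => (X.Edge p.1.1 a q.1.1 ∧ p.1.2 = Y.start ∧ q.1.2 = Y.start) ∨
    (Y.Edge p.1.2 a q.1.2 ∧ p.1.1 = X.finish ∧ q.1.1 = X.finish)
  start := ⟨(X.start, Y.start), Or.inr rfl⟩
  finish := ⟨(X.finish, Y.finish), Or.inl rfl⟩
  edge_label := by
    rintro p q a b (⟨h, h1, h2⟩ | ⟨h, h1, h2⟩) (⟨k, k1, k2⟩ | ⟨k, k1, k2⟩)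
    · exact X.edge_label h k
    · exact absurd (k1.trans k2.symm) (X.step_ne ⟨a, h⟩)
    · exact absurd (k1.trans k2.symm) (Y.step_ne ⟨a, h⟩)
    · exact Y.edge_label h k
  edge_dir := by
    rintro p q a b (⟨h, h1, h2⟩ | ⟨h, h1, h2⟩) (⟨k, k1, k2⟩ | ⟨k, k1, k2⟩)
    · exact X.edge_dir h k
    · exact X.step_ne ⟨a, h⟩ (k2.trans k1.symm)
    · exact Y.step_ne ⟨a, h⟩ (k2.trans k1.symm)
    · exact Y.edge_dir h k
  isTree := by
    set V := {p : X.V × Y.V // p.1 = X.finish ∨ p.2 = Y.start} with hV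
    set R : V → V → Prop := fun p q => ∃ a,
      (X.Edge p.1.1 a q.1.1 ∧ p.1.2 = Y.start ∧ q.1.2 = Y.start) ∨
      (Y.Edge p.1.2 a q.1.2 ∧ p.1.1 = X.finish ∧ q.1.1 = X.finish) with hR
    have hRX : ∀ {p q}, R p q → (X.Step p.1.1 q.1.1 ∧ p.1.2 = Y.start ∧ q.1.2 = Y.start) ∨
        (Y.Step p.1.2 q.1.2 ∧ p.1.1 = X.finish ∧ q.1.1 = X.finish) := by
      rintro p q ⟨a, h | h⟩
      · exact Or.inl ⟨⟨a, h.1⟩, h.2⟩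
      · exact Or.inr ⟨⟨a, h.1⟩, h.2⟩
    have hadj : ∀ {p q}, (SimpleGraph.fromRel R).Adj p q →
        (X.graph.Adj p.1.1 q.1.1 ∧ p.1.2 = Y.start ∧ q.1.2 = Y.start) ∨
        (Y.graph.Adj p.1.2 q.1.2 ∧ p.1.1 = X.finish ∧ q.1.1 = X.finish) := by
      intro p q h
      rw [SimpleGraph.fromRel_adj] at h
      rcases h.2 with h | h
      · rcases hRX h with h | h
        · exact Or.inl ⟨X.graph_adj.2 (Or.inl h.1), h.2⟩
        · exact Or.inr ⟨Y.graph_adj.2 (Or.inl h.1), h.2⟩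
      · rcases hRX h with h | h
        · exact Or.inl ⟨X.graph_adj.2 (Or.inr h.1), h.2.2, h.2.1⟩
        · exact Or.inr ⟨Y.graph_adj.2 (Or.inr h.1), h.2.2, h.2.1⟩
    constructor
    · have : Nonempty V := ⟨⟨(X.start, Y.start), Or.inr rfl⟩⟩
      let FX : X.graph →g SimpleGraph.fromRel R :=
        ⟨fun p => ⟨(p, Y.start), Or.inr rfl⟩, by
          intro p q h
          rw [SimpleGraph.fromRel_adj]
          refine ⟨fun e => h.ne (congrArg (fun z : V => z.1.1) e), ?_⟩
          rcases X.graph_adj.1 h with ⟨a, h⟩ | ⟨a, h⟩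
          · exact Or.inl ⟨a, Or.inl ⟨h, rfl, rfl⟩⟩
          · exact Or.inr ⟨a, Or.inl ⟨h, rfl, rfl⟩⟩⟩
      let FY : Y.graph →g SimpleGraph.fromRel R :=
        ⟨fun p => ⟨(X.finish, p), Or.inl rfl⟩, by
          intro p q h
          rw [SimpleGraph.fromRel_adj]
          refine ⟨fun e => h.ne (congrArg (fun z : V => z.1.2) e), ?_⟩
          rcases Y.graph_adj.1 h with ⟨a, h⟩ | ⟨a, h⟩
          · exact Or.inl ⟨a, Or.inr ⟨h, rfl, rfl⟩⟩
          · exact Or.inr ⟨a, Or.inr ⟨h, rfl, rfl⟩⟩⟩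
      have key : ∀ p : V, (SimpleGraph.fromRel R).Reachable p
          ⟨(X.finish, Y.start), Or.inr rfl⟩ := by
        rintro ⟨⟨p, q⟩, (rfl : p = X.finish) | (rfl : q = Y.start)⟩
        · exact (Y.isTree.1.preconnected q Y.start).map FY
        · exact (X.isTree.1.preconnected p X.finish).map FX
      exact ⟨fun p q => (key p).trans (key q).symm⟩
    · rw [SimpleGraph.isAcyclic_iff_forall_adj_isBridge]
      intro p q hpq
      rw [SimpleGraph.isBridge_iff]
      have hXb := SimpleGraph.isAcyclic_iff_forall_adj_isBridge.1 X.isTree.2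
      have hYb := SimpleGraph.isAcyclic_iff_forall_adj_isBridge.1 Y.isTree.2
      rintro ⟨W⟩
      rcases hadj hpq with ⟨h, h1, h2⟩ | ⟨h, h1, h2⟩
      · have hb := SimpleGraph.isBridge_iff.1 (hXb h)
        apply hb
        have main : ∀ {x y : V}, ((SimpleGraph.fromRel R).deleteEdges {s(p, q)}).Walk x y →
            (X.graph.deleteEdges {s(p.1.1, q.1.1)}).Reachable x.1.1 y.1.1 := by
          intro x y W
          induction W with
          | nil => exact SimpleGraph.Reachable.refl _
          | @cons x z y hxz _ ih =>
            refine SimpleGraph.Reachable.trans ?_ ih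
            rw [SimpleGraph.deleteEdges_adj] at hxz
            rcases hadj hxz.1 with ⟨k, k1, k2⟩ | ⟨k, k1, k2⟩
            · apply SimpleGraph.Adj.reachable
              rw [SimpleGraph.deleteEdges_adj]
              refine ⟨k, fun hm => hxz.2 ?_⟩
              simp only [Set.mem_singleton_iff, Sym2.eq_iff] at hm ⊢
              rcases hm with hm | hm
              · exact Or.inl ⟨Subtype.ext (Prod.ext hm.1 (k1.trans h1.symm)),
                  Subtype.ext (Prod.ext hm.2 (k2.trans h2.symm))⟩
              · exact Or.inr ⟨Subtype.ext (Prod.ext hm.1 (k1.trans h2.symm)),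
                  Subtype.ext (Prod.ext hm.2 (k2.trans h1.symm))⟩
            · rw [k1, k2]
        exact main W
      · have hb := SimpleGraph.isBridge_iff.1 (hYb h)
        apply hb
        have main : ∀ {x y : V}, ((SimpleGraph.fromRel R).deleteEdges {s(p, q)}).Walk x y →
            (Y.graph.deleteEdges {s(p.1.2, q.1.2)}).Reachable x.1.2 y.1.2 := by
          intro x y W
          induction W with
          | nil => exact SimpleGraph.Reachable.refl _
          | @cons x z y hxz _ ih =>
            refine SimpleGraph.Reachable.trans ?_ ih
            rw [SimpleGraph.deleteEdges_adj] at hxz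
            rcases hadj hxz.1 with ⟨k, k1, k2⟩ | ⟨k, k1, k2⟩
            · rw [k1, k2]
            · apply SimpleGraph.Adj.reachable
              rw [SimpleGraph.deleteEdges_adj]
              refine ⟨k, fun hm => hxz.2 ?_⟩
              simp only [Set.mem_singleton_iff, Sym2.eq_iff] at hm ⊢
              rcases hm with hm | hm
              · exact Or.inl ⟨Subtype.ext (Prod.ext (k1.trans h1.symm) hm.1),
                  Subtype.ext (Prod.ext (k2.trans h2.symm) hm.2)⟩
              · exact Or.inr ⟨Subtype.ext (Prod.ext (k1.trans h2.symm) hm.1),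
                  Subtype.ext (Prod.ext (k2.trans h1.symm) hm.2)⟩
        exact main W
  path := by
    refine Relation.ReflTransGen.trans (b := ⟨(X.finish, Y.start), Or.inr rfl⟩) ?_ ?_
    · exact Relation.ReflTransGen.lift
        (fun p => (⟨(p, Y.start), Or.inr rfl⟩ :
          {p : X.V × Y.V // p.1 = X.finish ∨ p.2 = Y.start}))
        (fun p q ⟨a, h⟩ => ⟨a, Or.inl ⟨h, rfl, rfl⟩⟩) _ _ X.path
    · exact Relation.ReflTransGen.lift
        (fun p => (⟨(X.finish, p), Or.inl rfl⟩ :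
          {p : X.V × Y.V // p.1 = X.finish ∨ p.2 = Y.start}))
        (fun p q ⟨a, h⟩ => ⟨a, Or.inr ⟨h, rfl, rfl⟩⟩) _ _ Y.path

/-- Unpruned `(+)`: the end vertex is moved to the start vertex. -/
def plus (X : STree A) : STree A :=
  { X with finish := X.start, path := Relation.ReflTransGen.refl }

/-- Unpruned `(*)`: the start vertex is moved to the end vertex. -/
def star (X : STree A) : STree A :=
  { X with start := X.finish, path := Relation.ReflTransGen.refl }

theorem iso_prod {X X' Y Y' : STree A} (h : Iso X X') (k : Iso Y Y') :
    Iso (prod X Y) (prod X' Y') := by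
  obtain ⟨f, f1, f2, f3⟩ := h
  obtain ⟨g, g1, g2, g3⟩ := k
  refine ⟨(f.prodCongr g).subtypeEquiv ?_, ?_, ?_, ?_⟩
  · rintro ⟨p, q⟩
    simp [← f3, ← g2]
  · rintro ⟨⟨p, q⟩, _⟩ a ⟨⟨p', q'⟩, _⟩
    change (X.Edge p a p' ∧ q = Y.start ∧ q' = Y.start) ∨
      (Y.Edge q a q' ∧ p = X.finish ∧ p' = X.finish) ↔
      (X'.Edge (f p) a (f p') ∧ g q = Y'.start ∧ g q' = Y'.start) ∨
      (Y'.Edge (g q) a (g q') ∧ f p = X'.finish ∧ f p' = X'.finish)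
    rw [f1, g1, ← f3, ← g2]
    simp
  · exact Subtype.ext (Prod.ext f2 g2)
  · exact Subtype.ext (Prod.ext f3 g3)

theorem iso_plus {X X' : STree A} (h : Iso X X') : Iso (plus X) (plus X') := by
  obtain ⟨f, f1, f2, f3⟩ := h
  exact ⟨f, f1, f2, f2⟩

theorem iso_star {X X' : STree A} (h : Iso X X') : Iso (star X) (star X') := by
  obtain ⟨f, f1, f2, f3⟩ := h
  exact ⟨f, f1, f3, f3⟩

/-- The base tree of a letter `a`: one edge, labelled `a`, from the start vertex to the end
vertex. -/
def base (a : A) : STree A where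
  V := Bool
  finite := inferInstance
  Edge := fun p b q => p = false ∧ b = a ∧ q = true
  start := false
  finish := true
  edge_label := by
    rintro p q b c ⟨-, rfl, -⟩ ⟨-, rfl, -⟩
    rfl
  edge_dir := by
    rintro p q b c ⟨rfl, -, rfl⟩ ⟨h, -, -⟩
    exact absurd h (by decide)
  isTree := by
    have h : (SimpleGraph.fromRel (fun p q : Bool => ∃ b : A, p = false ∧ b = a ∧ q = true)) =
        (⊤ : SimpleGraph Bool) := by
      ext p q
      cases p <;> cases q <;> simp
    rw [h]
    refine ⟨SimpleGraph.connected_top, ?_⟩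
    intro p c hc
    have h3 := hc.three_le_length
    have h4 := hc.support_nodup.length_le_card
    simp at h4
    omega
  path := Relation.ReflTransGen.single ⟨a, rfl, rfl, rfl⟩

/-! ### Closure properties -/

theorem IsLeftAdequate.retract {X Y : STree A} (hX : X.IsLeftAdequate) (h : IsRetractOf Y X) :
    Y.IsLeftAdequate := by
  obtain ⟨r, i, h⟩ := isRetractOf_iff.1 h
  intro p
  have := r.map_path (hX (i.toFun p))
  rwa [r.map_start, h] at this

theorem IsRightAdequate.retract {X Y : STree A} (hX : X.IsRightAdequate) (h : IsRetractOf Y X) :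
    Y.IsRightAdequate := by
  obtain ⟨r, i, h⟩ := isRetractOf_iff.1 h
  intro p
  have := r.map_path (hX (i.toFun p))
  rwa [r.map_finish, h] at this

theorem IsNontrivial.retract {X Y : STree A} (hX : X.IsNontrivial) (h : IsRetractOf Y X) :
    Y.IsNontrivial := by
  obtain ⟨r, -, -⟩ := isRetractOf_iff.1 h
  have : Nontrivial X.V := hX
  obtain ⟨q, hq⟩ := X.isTree.1.preconnected.exists_adj_of_nontrivial X.start
  rcases X.graph_adj.1 hq with h | h
  · exact ⟨_, _, Y.step_ne (r.map_step h)⟩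
  · exact ⟨_, _, Y.step_ne (r.map_step h)⟩

theorem prod_path_left {X Y : STree A} {p q : X.V} (h : X.Path p q) :
    (prod X Y).Path ⟨(p, Y.start), Or.inr rfl⟩ ⟨(q, Y.start), Or.inr rfl⟩ :=
  Relation.ReflTransGen.lift (p := (prod X Y).Step)
    (fun p => ⟨(p, Y.start), Or.inr rfl⟩) (fun _ _ ⟨a, h⟩ => ⟨a, Or.inl ⟨h, rfl, rfl⟩⟩) _ _ h

theorem prod_path_right {X Y : STree A} {p q : Y.V} (h : Y.Path p q) :
    (prod X Y).Path ⟨(X.finish, p), Or.inl rfl⟩ ⟨(X.finish, q), Or.inl rfl⟩ :=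
  Relation.ReflTransGen.lift (p := (prod X Y).Step)
    (fun p => ⟨(X.finish, p), Or.inl rfl⟩) (fun _ _ ⟨a, h⟩ => ⟨a, Or.inr ⟨h, rfl, rfl⟩⟩) _ _ h

theorem IsLeftAdequate.prod {X Y : STree A} (hX : X.IsLeftAdequate) (hY : Y.IsLeftAdequate) :
    (prod X Y).IsLeftAdequate := by
  rintro ⟨⟨p, q⟩, (rfl : p = X.finish) | (rfl : q = Y.start)⟩
  · exact (prod_path_left X.path).trans (prod_path_right (hY q))
  · exact prod_path_left (hX p)

theorem IsRightAdequate.prod {X Y : STree A} (hX : X.IsRightAdequate)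
    (hY : Y.IsRightAdequate) : (prod X Y).IsRightAdequate := by
  rintro ⟨⟨p, q⟩, (rfl : p = X.finish) | (rfl : q = Y.start)⟩
  · exact prod_path_right (hY q)
  · exact (prod_path_left (hX p)).trans (prod_path_right Y.path)

theorem IsNontrivial.prod {X Y : STree A} (hX : X.IsNontrivial) :
    (prod X Y).IsNontrivial := by
  obtain ⟨p, q, h⟩ := hX
  exact ⟨⟨(p, Y.start), Or.inr rfl⟩, ⟨(q, Y.start), Or.inr rfl⟩,
    fun e => h (congrArg (fun z => z.1.1) e)⟩

theorem base_isPruned (a : A) : (base a).IsPruned := by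
  intro π _ p
  cases p
  · exact π.map_start
  · exact π.map_finish

theorem base_isNontrivial (a : A) : (base a).IsNontrivial := ⟨false, true, Bool.false_ne_true⟩

theorem base_isLeftAdequate (a : A) : (base a).IsLeftAdequate := by
  intro p
  cases p
  · exact Relation.ReflTransGen.refl
  · exact (base a).path

theorem base_isRightAdequate (a : A) : (base a).IsRightAdequate := by
  intro p
  cases p
  · exact (base a).path
  · exact Relation.ReflTransGen.refl

/-- Isomorphism as a setoid. -/
def isoSetoid (A : Type u) : Setoid (STree A) where
  r := Iso
  iseqv := ⟨Iso.refl, Iso.symm, Iso.trans⟩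

end STree

/-! ## Isomorphism types of trees -/

/-- `UT¹(A)`: the isomorphism types of `A`-trees. -/
def UT1 (A : Type u) := Quotient (STree.isoSetoid A)

namespace UT1

variable {A : Type u}

/-- The isomorphism type of a tree. -/
def mk (X : STree A) : UT1 A := Quotient.mk (STree.isoSetoid A) X

theorem mk_eq {X Y : STree A} (h : STree.Iso X Y) : mk X = mk Y :=
  Quotient.sound (s := STree.isoSetoid A) h

/-- Unpruned multiplication. -/
def prod : UT1 A → UT1 A → UT1 A :=
  Quotient.lift₂ (s₁ := STree.isoSetoid A) (s₂ := STree.isoSetoid A)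
    (fun X Y => mk (X.prod Y)) (fun _ _ _ _ h k => mk_eq (STree.iso_prod h k))

/-- Unpruned `(+)`. -/
def plus : UT1 A → UT1 A :=
  Quotient.lift (s := STree.isoSetoid A) (fun X => mk X.plus)
    (fun _ _ h => mk_eq (STree.iso_plus h))

/-- Unpruned `(*)`. -/
def star : UT1 A → UT1 A :=
  Quotient.lift (s := STree.isoSetoid A) (fun X => mk X.star)
    (fun _ _ h => mk_eq (STree.iso_star h))

/-- The pruning map: it takes (the isomorphism type of) `X` to that of the pruned retract of `X`,
which exists by `exists_pruned_retract` and is unique up to isomorphism by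
`pruned_retract_unique`. -/
noncomputable def pruning : UT1 A → UT1 A :=
  Quotient.lift (s := STree.isoSetoid A) (fun X => mk X.exists_pruned_retract.choose)
    (fun X X' h => mk_eq (STree.pruned_retract_unique X.exists_pruned_retract.choose_spec.1
      X'.exists_pruned_retract.choose_spec.1
      (X.exists_pruned_retract.choose_spec.2.of_iso_right h)
      X'.exists_pruned_retract.choose_spec.2))

theorem pruning_mk (X : STree A) :
    ∃ Y : STree A, pruning (mk X) = mk Y ∧ Y.IsPruned ∧ STree.IsRetractOf Y X :=
  ⟨_, rfl, X.exists_pruned_retract.choose_spec⟩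

end UT1

/-! ## The algebras of pruned one-sided adequate trees -/

/-- `LT(A)`: the isomorphism types of non-trivial pruned left adequate `A`-trees. -/
def LT (A : Type u) :=
  {x : UT1 A // ∃ X : STree A, UT1.mk X = x ∧ X.IsNontrivial ∧ X.IsPruned ∧ X.IsLeftAdequate}

/-- `RT(A)`: the isomorphism types of non-trivial pruned right adequate `A`-trees. -/
def RT (A : Type u) :=
  {x : UT1 A // ∃ X : STree A, UT1.mk X = x ∧ X.IsNontrivial ∧ X.IsPruned ∧ X.IsRightAdequate}

/-- `LT(A)` with pruned multiplication and pruned `+`. -/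
noncomputable instance LT.instAlgebra21 (A : Type u) : Algebra21 (LT A) where
  mul x y := ⟨(x.1.prod y.1).pruning, by
    obtain ⟨_, X, rfl, hX1, -, hX2⟩ := x
    obtain ⟨_, Y, rfl, -, -, hY2⟩ := y
    obtain ⟨Z, hZ, hZ1, hZ2⟩ := UT1.pruning_mk (X.prod Y)
    exact ⟨Z, hZ.symm, hX1.prod.retract hZ2, hZ1, (hX2.prod hY2).retract hZ2⟩⟩
  unary x := ⟨x.1.plus.pruning, by
    obtain ⟨_, X, rfl, hX1, -, hX2⟩ := x
    obtain ⟨Z, hZ, hZ1, hZ2⟩ := UT1.pruning_mk X.plus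
    exact ⟨Z, hZ.symm, STree.IsNontrivial.retract (X := X.plus) hX1 hZ2, hZ1,
      STree.IsLeftAdequate.retract (X := X.plus) hX2 hZ2⟩⟩

/-- `RT(A)` with pruned multiplication and pruned `*`. -/
noncomputable instance RT.instAlgebra21 (A : Type u) : Algebra21 (RT A) where
  mul x y := ⟨(x.1.prod y.1).pruning, by
    obtain ⟨_, X, rfl, hX1, -, hX2⟩ := x
    obtain ⟨_, Y, rfl, -, -, hY2⟩ := y
    obtain ⟨Z, hZ, hZ1, hZ2⟩ := UT1.pruning_mk (X.prod Y)
    exact ⟨Z, hZ.symm, hX1.prod.retract hZ2, hZ1, (hX2.prod hY2).retract hZ2⟩⟩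
  unary x := ⟨x.1.star.pruning, by
    obtain ⟨_, X, rfl, hX1, -, hX2⟩ := x
    obtain ⟨Z, hZ, hZ1, hZ2⟩ := UT1.pruning_mk X.star
    exact ⟨Z, hZ.symm, STree.IsNontrivial.retract (X := X.star) hX1 hZ2, hZ1,
      STree.IsRightAdequate.retract (X := X.star) hX2 hZ2⟩⟩

/-- The base trees as elements of `LT(A)`. -/
def LT.base {A : Type u} (a : A) : LT A :=
  ⟨UT1.mk (STree.base a), STree.base a, rfl, STree.base_isNontrivial a, STree.base_isPruned a,
    STree.base_isLeftAdequate a⟩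

/-- The base trees as elements of `RT(A)`. -/
def RT.base {A : Type u} (a : A) : RT A :=
  ⟨UT1.mk (STree.base a), STree.base a, rfl, STree.base_isNontrivial a, STree.base_isPruned a,
    STree.base_isRightAdequate a⟩

end AdequateTrees

/-!
The theorem rests on the maps out of a tree. Pruned retracts of two trees are isomorphic if and only
if there are morphisms between the trees in both directions (`STree.HomEquiv`), so that the elements
of `LT(A)` are the classes of non-trivial left adequate trees under this equivalence, and pruning
plays no further part. Whether two trees are equivalent is decided by the maps from them to
arbitrary labelled digraphs (`STree.HomAt`), and these maps are easy to describe for the unpruned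
operations: gluing is a pushout (`STree.homAt_prod`), and moving the end vertex forgets its image
(`STree.homAt_plus`). The algebraic laws follow. The only facts about trees that they need are that
directed walks from the start vertex have a well-defined length and that a vertex of a left adequate
tree is the target of at most one edge; hence the walks of a given length to the end vertex have the
same start, so that a morphism `P × X → Q × X` respects the points of gluing. This gives
`x R* x⁺` (`STree.nonempty_hom_prod_plus`).

For freeness, every left adequate tree is described by a term (`TreeTerm.exists_tree_homEquiv`), so
that the base trees generate `LT(A)`. It remains to see that two terms with equivalent trees have
the same value in every left adequate semigroup `N` (`TreeTerm.ev_eq_of_homEquiv`). Consider the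
digraph whose vertices are the idempotents of the form `x⁺` of `N` with an identity adjoined, with
an edge labelled `a` from `e` to `f` if `e ≤ (a f)⁺`. The maps from a tree to this digraph have a
largest element, which takes a vertex to `x⁺` for the value `x` of the part of the tree above the
vertex. If `e₀, …, eₙ` are the images of the trunk vertices under the largest map and `a₁, …, aₙ`
are the labels on the trunk, then the value of the tree is `e₀ a₁ e₁ ⋯ aₙ eₙ`: here `eᵢ` also has
a factor `(a x)⁺` for the trunk edge which leaves its vertex, but this factor is absorbed, as
`(a x)⁺ a x = a x`. So the value depends only on the maps out of the tree.

The right adequate case follows by reversing all edges, which turns `RT(A)` into the opposite of an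
algebra of left adequate trees.
-/

namespace AdequateTrees

namespace STree

variable {A : Type u}

/-! ### Maps from trees into labelled digraphs -/

/-- There is an edge-preserving map from the tree `X` to the labelled digraph with edge relation
`E` which takes the start vertex to `z` and the end vertex to `w`. -/
def HomAt (X : STree A) {W : Type v} (E : W → A → W → Prop) (z w : W) : Prop :=
  ∃ f : X.V → W, (∀ p a q, X.Edge p a q → E (f p) a (f q)) ∧ f X.start = z ∧ f X.finish = w

/-- The tree with one vertex. -/
def trivial (A : Type u) : STree A where
  V := Unit
  finite := inferInstance
  Edge := fun _ _ _ => False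
  start := ()
  finish := ()
  edge_label := fun h => h.elim
  edge_dir := fun h => h.elim
  isTree := SimpleGraph.IsTree.of_subsingleton
  path := Relation.ReflTransGen.refl

theorem trivial_isLeftAdequate : (trivial A).IsLeftAdequate := fun _ => Relation.ReflTransGen.refl

theorem homAt_trivial {W : Type v} {E : W → A → W → Prop} {z w : W} :
    (trivial A).HomAt E z w ↔ z = w := by
  constructor
  · rintro ⟨f, -, rfl, rfl⟩
    rfl
  · rintro rfl
    exact ⟨fun _ => z, fun _ _ _ h => h.elim, rfl, rfl⟩

theorem homAt_base {W : Type v} {E : W → A → W → Prop} {a : A} {z w : W} :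
    (base a).HomAt E z w ↔ E z a w := by
  constructor
  · rintro ⟨f, hf, rfl, rfl⟩
    exact hf _ _ _ ⟨rfl, rfl, rfl⟩
  · intro h
    refine ⟨fun b => cond b w z, ?_, rfl, rfl⟩
    rintro p b q ⟨rfl, rfl, rfl⟩
    exact h

theorem homAt_plus {X : STree A} {W : Type v} {E : W → A → W → Prop} {z w : W} :
    X.plus.HomAt E z w ↔ z = w ∧ ∃ y, X.HomAt E z y := by
  constructor
  · rintro ⟨f, hf, rfl, rfl⟩
    exact ⟨rfl, _, f, hf, rfl, rfl⟩
  · rintro ⟨rfl, _, f, hf, rfl, -⟩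
    exact ⟨f, hf, rfl, rfl⟩

/-- The gluing `X × Y` is a pushout. -/
theorem homAt_prod {X Y : STree A} {W : Type v} {E : W → A → W → Prop} {z w : W} :
    (X.prod Y).HomAt E z w ↔ ∃ m, X.HomAt E z m ∧ Y.HomAt E m w := by
  constructor
  · rintro ⟨f, hf, rfl, rfl⟩
    exact ⟨f ⟨(X.finish, Y.start), Or.inr rfl⟩,
      ⟨fun p => f ⟨(p, Y.start), Or.inr rfl⟩, fun p a q h => hf _ _ _ (Or.inl ⟨h, rfl, rfl⟩),
        rfl, rfl⟩,
      ⟨fun p => f ⟨(X.finish, p), Or.inl rfl⟩, fun p a q h => hf _ _ _ (Or.inr ⟨h, rfl, rfl⟩),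
        rfl, rfl⟩⟩
  · rintro ⟨_, ⟨f, hf, rfl, rfl⟩, ⟨g, hg, hgf, rfl⟩⟩
    classical
    let h : (X.prod Y).V → W := fun p => if p.1.2 = Y.start then f p.1.1 else g p.1.2
    have hleft : ∀ p : (X.prod Y).V, p.1.2 = Y.start → h p = f p.1.1 := fun p hp => if_pos hp
    have hright : ∀ p : (X.prod Y).V, p.1.1 = X.finish → h p = g p.1.2 := by
      intro p hp
      by_cases hq : p.1.2 = Y.start
      · rw [hleft p hq, hp, hq, hgf]
      · exact if_neg hq
    refine ⟨h, ?_, hleft _ rfl, hright _ rfl⟩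
    rintro p a q (⟨k, k1, k2⟩ | ⟨k, k1, k2⟩)
    · rw [hleft p k1, hleft q k2]
      exact hf _ _ _ k
    · rw [hright p k1, hright q k2]
      exact hg _ _ _ k

theorem HomAt.comp_hom {X Y : STree A} (g : Hom X Y) {W : Type v} {E : W → A → W → Prop}
    {z w : W} (h : Y.HomAt E z w) : X.HomAt E z w := by
  obtain ⟨f, hf, rfl, rfl⟩ := h
  exact ⟨fun p => f (g.toFun p), fun p a q h => hf _ _ _ (g.map_edge h),
    congrArg f g.map_start, congrArg f g.map_finish⟩

theorem homAt_iff_nonempty_hom {X Y : STree A} :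
    X.HomAt Y.Edge Y.start Y.finish ↔ Nonempty (Hom X Y) :=
  ⟨fun ⟨f, hf, h1, h2⟩ => ⟨⟨f, fun h => hf _ _ _ h, h1, h2⟩⟩,
    fun ⟨f⟩ => ⟨f.toFun, fun _ _ _ h => f.map_edge h, f.map_start, f.map_finish⟩⟩

/-- Homomorphic equivalence of trees: there are morphisms in both directions. -/
def HomEquiv (X Y : STree A) : Prop := Nonempty (Hom X Y) ∧ Nonempty (Hom Y X)

namespace HomEquiv

theorem refl (X : STree A) : HomEquiv X X :=
  have f : Hom X X := ⟨id, fun h => h, rfl, rfl⟩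
  ⟨⟨f⟩, ⟨f⟩⟩

theorem symm {X Y : STree A} (h : HomEquiv X Y) : HomEquiv Y X := ⟨h.2, h.1⟩

theorem trans {X Y Z : STree A} (h : HomEquiv X Y) (k : HomEquiv Y Z) : HomEquiv X Z := by
  obtain ⟨⟨f⟩, ⟨f'⟩⟩ := h
  obtain ⟨⟨g⟩, ⟨g'⟩⟩ := k
  exact ⟨⟨g.comp f⟩, ⟨f'.comp g'⟩⟩

theorem homAt_iff {X Y : STree A} (h : HomEquiv X Y) {W : Type v} {E : W → A → W → Prop}
    {z w : W} : X.HomAt E z w ↔ Y.HomAt E z w := by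
  obtain ⟨⟨f⟩, ⟨g⟩⟩ := h
  exact ⟨HomAt.comp_hom g, HomAt.comp_hom f⟩

/-- A tree is determined up to homomorphic equivalence by the maps out of it. -/
theorem of_homAt_iff {X Y : STree A}
    (h : ∀ (W : Type) (E : W → A → W → Prop) (z w : W), X.HomAt E z w ↔ Y.HomAt E z w) :
    HomEquiv X Y :=
  ⟨homAt_iff_nonempty_hom.1 ((h _ _ _ _).2 (homAt_iff_nonempty_hom.2 (refl Y).1)),
    homAt_iff_nonempty_hom.1 ((h _ _ _ _).1 (homAt_iff_nonempty_hom.2 (refl X).1))⟩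

theorem prod {X X' Y Y' : STree A} (h : HomEquiv X X') (k : HomEquiv Y Y') :
    HomEquiv (X.prod Y) (X'.prod Y') :=
  of_homAt_iff fun _ _ _ _ => by simp only [homAt_prod, h.homAt_iff, k.homAt_iff]

theorem plus {X X' : STree A} (h : HomEquiv X X') : HomEquiv X.plus X'.plus :=
  of_homAt_iff fun _ _ _ _ => by simp only [homAt_plus, h.homAt_iff]

theorem of_iso {X Y : STree A} (h : Iso X Y) : HomEquiv X Y := by
  obtain ⟨f, g, -⟩ := h.exists_hom
  exact ⟨⟨f⟩, ⟨g⟩⟩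

theorem of_isRetractOf {X Y : STree A} (h : IsRetractOf Y X) : HomEquiv Y X := by
  obtain ⟨r, i, -⟩ := isRetractOf_iff.1 h
  exact ⟨⟨i⟩, ⟨r⟩⟩

theorem trivial_prod (X : STree A) : HomEquiv ((trivial A).prod X) X :=
  of_homAt_iff fun _ _ _ _ => by simp [homAt_prod, homAt_trivial]

theorem prod_trivial (X : STree A) : HomEquiv (X.prod (trivial A)) X :=
  of_homAt_iff fun _ _ _ _ => by simp [homAt_prod, homAt_trivial]

end HomEquiv

/-- Homomorphically equivalent pruned trees are isomorphic. -/
theorem IsPruned.iso_of_homEquiv {Y Z : STree A} (hY : Y.IsPruned) (hZ : Z.IsPruned)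
    (h : HomEquiv Y Z) : Iso Y Z := by
  obtain ⟨⟨f⟩, ⟨g⟩⟩ := h
  obtain ⟨a, ha, -⟩ := hY.exists_inverse (g.comp f)
  obtain ⟨b, -, hb⟩ := hZ.exists_inverse (f.comp g)
  have h1 : ∀ p, (a.comp g).toFun (f.toFun p) = p := ha
  have h2 : ∀ q, f.toFun ((g.comp b).toFun q) = q := hb
  refine iso_of_hom f (a.comp g) h1 fun q => ?_
  rw [← h2 q, h1]

theorem IsNontrivial.of_hom {X Y : STree A} (hX : X.IsNontrivial) (r : Hom X Y) :
    Y.IsNontrivial := by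
  have : Nontrivial X.V := hX
  obtain ⟨q, hq⟩ := X.isTree.1.preconnected.exists_adj_of_nontrivial X.start
  rcases X.graph_adj.1 hq with h | h
  · exact ⟨_, _, Y.step_ne (r.map_step h)⟩
  · exact ⟨_, _, Y.step_ne (r.map_step h)⟩

theorem not_isNontrivial_trivial : ¬ (trivial A).IsNontrivial :=
  fun ⟨_, _, h⟩ => h rfl

/-! ### Directed walks in trees -/

/-- There is a directed walk of length `n` from `v` to `w`. -/
def DWalk (X : STree A) : ℕ → X.V → X.V → Prop
  | 0, v, w => v = w
  | n + 1, v, w => ∃ m, X.DWalk n v m ∧ X.Step m w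

theorem exists_dWalk {X : STree A} {v w : X.V} (h : X.Path v w) : ∃ n, X.DWalk n v w := by
  induction h with
  | refl => exact ⟨0, rfl⟩
  | tail _ h ih =>
    obtain ⟨n, hn⟩ := ih
    exact ⟨n + 1, _, hn, h⟩

theorem DWalk.trans {X : STree A} {m n : ℕ} {p q r : X.V} (h : X.DWalk m p q)
    (k : X.DWalk n q r) : X.DWalk (m + n) p r := by
  induction n generalizing r with
  | zero =>
    obtain rfl : q = r := k
    exact h
  | succ n ih =>
    obtain ⟨s, hs, k⟩ := k
    exact ⟨s, ih hs, k⟩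

theorem HomAt.dWalk {X Y : STree A} {z w : Y.V} {n : ℕ} (h : X.HomAt Y.Edge z w)
    (hn : X.DWalk n X.start X.finish) : Y.DWalk n z w := by
  obtain ⟨f, hf, rfl, rfl⟩ := h
  generalize X.finish = p at hn
  induction n generalizing p with
  | zero =>
    obtain rfl : X.start = p := hn
    rfl
  | succ n ih =>
    obtain ⟨m, hm, a, ha⟩ := hn
    exact ⟨f m, ih m hm, a, hf _ _ _ ha⟩

theorem graph_isTree (X : STree A) : X.graph.IsTree := X.isTree

/-- A directed walk in a tree does not turn back: an edge that leaves the end of a directed path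
(here traversed backwards) leads to a new vertex. -/
theorem notMem_support_of_step {X : STree A} {v m w : X.V} {p : X.graph.Walk m v}
    (hp : p.IsPath) (hs : p.length ≠ 0 → X.Step p.snd m) (h : X.Step m w) : w ∉ p.support := by
  intro hw
  have hadj : X.graph.Adj m w := X.graph_adj.2 (Or.inl h)
  have hsnd := X.graph_isTree.2.eq_snd_of_adj_start hp hadj hw
  obtain ⟨a, ha⟩ := h
  cases p with
  | nil => exact hadj.ne hsnd.symm
  | cons k p =>
    obtain ⟨b, hb⟩ := hs (by simp)
    rw [← hsnd] at hb
    exact X.edge_dir ha hb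

theorem DWalk.exists_isPath {X : STree A} {n : ℕ} {v w : X.V} (h : X.DWalk n v w) :
    ∃ p : X.graph.Walk w v, p.IsPath ∧ p.length = n ∧ (p.length ≠ 0 → X.Step p.snd w) := by
  induction n generalizing w with
  | zero =>
    obtain rfl : v = w := h
    exact ⟨SimpleGraph.Walk.nil, SimpleGraph.Walk.IsPath.nil, rfl, fun h => (h rfl).elim⟩
  | succ n ih =>
    obtain ⟨m, hm, h⟩ := h
    obtain ⟨p, hp, hl, hs⟩ := ih hm
    exact ⟨SimpleGraph.Walk.cons (X.graph_adj.2 (Or.inr h)) p,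
      (SimpleGraph.Walk.cons_isPath_iff _ _).2 ⟨hp, notMem_support_of_step hp hs h⟩,
      by simp [hl], fun _ => by simpa using h⟩

theorem isPath_unique {X : STree A} {v w : X.V} {p q : X.graph.Walk v w} (hp : p.IsPath)
    (hq : q.IsPath) : p = q :=
  (X.graph_isTree.existsUnique_path v w).unique hp hq

theorem DWalk.length_unique {X : STree A} {m n : ℕ} {v w : X.V} (h : X.DWalk m v w)
    (k : X.DWalk n v w) : m = n := by
  obtain ⟨p, hp, hpl, -⟩ := h.exists_isPath
  obtain ⟨q, hq, hql, -⟩ := k.exists_isPath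
  rw [← hpl, ← hql, isPath_unique hp hq]

theorem not_path_of_step {X : STree A} {p q : X.V} (h : X.Step p q) :
    ¬ X.Path q p := by
  intro k
  obtain ⟨n, hn⟩ := exists_dWalk k
  have := (DWalk.trans (m := 1) ⟨p, rfl, h⟩ hn).length_unique (n := 0) rfl
  omega

namespace IsLeftAdequate

variable {X : STree A}

/-- In a left adequate tree, every vertex is the target of at most one edge. -/
theorem step_unique (hX : X.IsLeftAdequate) {p q r : X.V} (h : X.Step p r)
    (k : X.Step q r) : p = q := by
  have key : ∀ {p}, X.Step p r → ∃ P : X.graph.Walk r X.start, P.IsPath ∧ P.snd = p := by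
    intro p h
    obtain ⟨n, hn⟩ := exists_dWalk (hX p)
    obtain ⟨P, hP, -, hs⟩ := hn.exists_isPath
    exact ⟨SimpleGraph.Walk.cons (X.graph_adj.2 (Or.inr h)) P,
      (SimpleGraph.Walk.cons_isPath_iff _ _).2 ⟨hP, notMem_support_of_step hP hs h⟩, by simp⟩
  obtain ⟨P, hP, rfl⟩ := key h
  obtain ⟨Q, hQ, rfl⟩ := key k
  rw [isPath_unique hP hQ]

/-- In a left adequate tree, the start of a directed walk is determined by its end and its
length. -/
theorem dWalk_unique (hX : X.IsLeftAdequate) {n : ℕ} {p q r : X.V} (h : X.DWalk n p r)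
    (k : X.DWalk n q r) : p = q := by
  induction n generalizing r with
  | zero => exact Eq.trans (b := r) h (Eq.symm k)
  | succ n ih =>
    obtain ⟨s, hs, h⟩ := h
    obtain ⟨t, ht, k⟩ := k
    obtain rfl := hX.step_unique h k
    exact ih hs ht

/-- The vertices of a left adequate tree are graded by their distance from the start vertex. -/
theorem exists_depth (hX : X.IsLeftAdequate) :
    ∃ d : X.V → ℕ, d X.start = 0 ∧ ∀ {p q}, X.Step p q → d q = d p + 1 := by
  choose d hd using fun p => exists_dWalk (hX p)
  exact ⟨d, (hd X.start).length_unique (n := 0) rfl,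
    fun {p q} h => (hd q).length_unique (n := d p + 1) ⟨p, hd p, h⟩⟩

/-- At most one of the edges leaving a vertex of a left adequate tree leads towards a given
vertex. -/
theorem step_unique_of_path (hX : X.IsLeftAdequate) {v p q r : X.V} (h : X.Step v p)
    (k : X.Step v q) (hp : X.Path p r) (hq : X.Path q r) : p = q := by
  obtain ⟨m, hm⟩ := exists_dWalk hp
  obtain ⟨n, hn⟩ := exists_dWalk hq
  have := (DWalk.trans (m := 1) ⟨v, rfl, h⟩ hm).length_unique
    (DWalk.trans (m := 1) ⟨v, rfl, k⟩ hn)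
  obtain rfl : m = n := by omega
  exact hX.dWalk_unique hm hn

/-- Out of a left adequate tree, morphisms can be built from simulations: the images of the
vertices are chosen one after the other, moving away from the start vertex. -/
theorem nonempty_hom_of_simulation (hX : X.IsLeftAdequate) {Y : STree A}
    {R : X.V → Y.V → Prop} (hstart : R X.start Y.start)
    (hsim : ∀ p a q y, R p y → X.Edge p a q → ∃ z, Y.Edge y a z ∧ R q z)
    (hfinish : ∀ y, R X.finish y → y = Y.finish) : Nonempty (Hom X Y) := by
  classical
  obtain ⟨d, hd0, hd⟩ := hX.exists_depth
  have hpar : ∀ q, ∃ p, ∀ p', X.Step p' q → p' = p := by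
    intro q
    by_cases h : ∃ p, X.Step p q
    · obtain ⟨p, hp⟩ := h
      exact ⟨p, fun p' h => hX.step_unique h hp⟩
    · exact ⟨q, fun p' h' => (h ⟨p', h'⟩).elim⟩
  choose par hpar using hpar
  have hnext : ∀ q y, ∃ z, ∀ a, R (par q) y → X.Edge (par q) a q → Y.Edge y a z ∧ R q z := by
    intro q y
    by_cases h : ∃ a, R (par q) y ∧ X.Edge (par q) a q
    · obtain ⟨a, h1, h2⟩ := h
      obtain ⟨z, hz⟩ := hsim _ _ _ _ h1 h2
      refine ⟨z, fun b _ hb => ?_⟩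
      rwa [X.edge_label hb h2]
    · exact ⟨y, fun a h1 h2 => (h ⟨a, h1, h2⟩).elim⟩
  choose next hnext using hnext
  -- `F n` has the right values at the vertices of depth `n`
  let F : ℕ → X.V → Y.V := fun n =>
    Nat.rec (fun _ => Y.start) (fun _ f q => next q (f (par q))) n
  let f : X.V → Y.V := fun p => F (d p) p
  have hf : ∀ {p a q}, X.Edge p a q → f q = next q (f p) ∧ p = par q := by
    intro p a q h
    have hp := hpar q p ⟨a, h⟩
    refine ⟨?_, hp⟩
    change F (d q) q = next q (F (d p) p)
    rw [hd ⟨a, h⟩, hp]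
  have hfs : f X.start = Y.start := by
    change F (d X.start) X.start = _
    rw [hd0]
    rfl
  have hR : ∀ p, R p (f p) := by
    intro p
    induction hX p with
    | refl => rwa [hfs]
    | @tail p q _ h ih =>
      obtain ⟨a, ha⟩ := h
      obtain ⟨h1, h2⟩ := hf ha
      rw [h1]
      subst h2
      exact (hnext q _ a ih ha).2
  refine ⟨⟨f, fun {p a q} h => ?_, hfs, hfinish _ (hR _)⟩⟩
  obtain ⟨h1, h2⟩ := hf h
  rw [h1]
  have := hR p
  subst h2
  exact (hnext q _ a this h).1

end IsLeftAdequate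

end STree

/-! ### Left adequate monoids -/

/-- The laws of a left adequate monoid, for a multiplication with unit and a unary operation `p`
(written `x ↦ x⁺` elsewhere); only the elements `p x` are required to be commuting idempotents. -/
structure IsLeftAdequateMonoid (M : Type w) [MulOneClass M] (p : M → M) : Prop where
  assoc : ∀ x y z : M, x * y * z = x * (y * z)
  proj_idem : ∀ x, p x * p x = p x
  proj_comm : ∀ x y, p x * p y = p y * p x
  proj_rStar : ∀ x a b, a * x = b * x ↔ a * p x = b * p x

namespace IsLeftAdequateMonoid

variable {M : Type w} [MulOneClass M] {p : M → M} (h : IsLeftAdequateMonoid M p)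
include h

theorem proj_mul_self (x : M) : p x * x = x := by
  have := (h.proj_rStar x (p x) 1).2 (by rw [one_mul, h.proj_idem])
  rwa [one_mul] at this

/-- Elements which are related by `R*` have the same projection. -/
theorem proj_eq_of_rStar {x y : M} (hxy : ∀ a b, a * x = b * x ↔ a * y = b * y) :
    p x = p y := by
  have h1 : p y * p x = 1 * p x := by
    rw [← h.proj_rStar, hxy, h.proj_rStar, h.proj_idem, one_mul]
  have h2 : p x * p y = 1 * p y := by
    rw [← h.proj_rStar, ← hxy, h.proj_rStar, h.proj_idem, one_mul]
  rw [one_mul] at h1 h2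
  rw [← h1, h.proj_comm, h2]

theorem proj_one : p 1 = 1 := by
  have := (h.proj_rStar 1 (p 1) 1).2 (by rw [one_mul, h.proj_idem])
  rwa [one_mul, mul_one] at this

theorem proj_proj (x : M) : p (p x) = p x :=
  h.proj_eq_of_rStar fun a b => (h.proj_rStar x a b).symm

theorem proj_mul_proj (x y : M) : p (x * p y) = p (x * y) :=
  h.proj_eq_of_rStar fun a b => by
    rw [← h.assoc, ← h.assoc, ← h.assoc, ← h.assoc, ← h.proj_rStar]

theorem proj_proj_mul (x y : M) : p (p x * y) = p x * p y := by
  rw [← h.proj_mul_proj]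
  set e := p x * p y with he
  have h1 : e * p e = p e := by
    have := (h.proj_rStar e e 1).1 (by
      rw [one_mul, he, h.assoc, ← h.assoc (p y), h.proj_comm y x, h.assoc, h.proj_idem,
        ← h.assoc, h.proj_idem])
    rwa [one_mul] at this
  have h2 : e * p e = p e * e := by
    rw [he, h.assoc, h.proj_comm y, ← h.assoc, h.proj_comm x, h.assoc]
  rw [← h1, h2, h.proj_mul_self]

/-- Left multiplication followed by the projection is monotone for the natural order of
projections, in which `e ≤ f` means `e * f = e`. -/
theorem proj_mul_mono {e f : M} (he : p e = e) (hf : p f = f) (hef : e * f = e) (x : M) :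
    p (x * e) * p (x * f) = p (x * e) := by
  have hfe : f * e = e := by rw [← he, ← hf, h.proj_comm, he, hf, hef]
  have h1 : p (x * f) * (x * e) = 1 * (x * e) := by
    calc p (x * f) * (x * e) = p (x * f) * (x * f) * e := by
            rw [h.assoc, h.assoc, hfe]
      _ = 1 * (x * e) := by rw [h.proj_mul_self, h.assoc, hfe, one_mul]
  rw [h.proj_comm, (h.proj_rStar _ _ _).1 h1, one_mul]

/-- Transitivity of the natural order of projections, in which `e ≤ f` means `e * f = e`. -/
theorem le_trans {e f g : M} (hef : e * f = e) (hfg : f * g = f) : e * g = e := by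
  rw [← hef, h.assoc, hfg]

end IsLeftAdequateMonoid

/-! ### Terms for left adequate trees -/

/-- Terms describing left adequate trees: the trivial tree, the tree obtained from `t` by adding a
side branch at the start vertex, which consists of an edge labelled `a` followed by `c`, and the
tree obtained from `c` by adding a new start vertex and an edge labelled `a` from it to the old
one. The end vertex is that of `t`, respectively `c`; in a side branch that of `c` is ignored. -/
inductive TreeTerm (A : Type u) : Type u
  | one : TreeTerm A
  | branch (a : A) (c t : TreeTerm A) : TreeTerm A
  | trunk (a : A) (c : TreeTerm A) : TreeTerm A

namespace TreeTerm

variable {A : Type u}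

/-- The tree described by a term. -/
def tree : TreeTerm A → STree A
  | one => STree.trivial A
  | branch a c t => (((STree.base a).prod c.tree).plus).prod t.tree
  | trunk a c => (STree.base a).prod c.tree

/-- The product of terms, describing the gluing of trees. -/
def mul : TreeTerm A → TreeTerm A → TreeTerm A
  | one, t => t
  | branch a c s, t => branch a c (s.mul t)
  | trunk a c, t => trunk a (c.mul t)

/-- The unary operation on terms, describing the move of the end vertex to the start vertex. -/
def plus : TreeTerm A → TreeTerm A
  | one => one
  | branch a c s => branch a c s.plus
  | trunk a c => branch a c one

section HomAt

variable {W : Type v} {E : W → A → W → Prop} {z w : W}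

theorem homAt_one : (one : TreeTerm A).tree.HomAt E z w ↔ z = w := STree.homAt_trivial

theorem homAt_branch {a : A} {c t : TreeTerm A} : (branch a c t).tree.HomAt E z w ↔
    (∃ x, E z a x ∧ ∃ y, c.tree.HomAt E x y) ∧ t.tree.HomAt E z w := by
  simp only [tree, STree.homAt_prod, STree.homAt_plus, STree.homAt_base]
  constructor
  · rintro ⟨_, ⟨rfl, y, x, h1, h2⟩, h3⟩
    exact ⟨⟨x, h1, y, h2⟩, h3⟩
  · rintro ⟨⟨x, h1, y, h2⟩, h3⟩
    exact ⟨_, ⟨rfl, y, x, h1, h2⟩, h3⟩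

theorem homAt_trunk {a : A} {c : TreeTerm A} : (trunk a c).tree.HomAt E z w ↔
    ∃ x, E z a x ∧ c.tree.HomAt E x w := by
  simp only [tree, STree.homAt_prod, STree.homAt_base]

theorem homAt_mul {s t : TreeTerm A} : (s.mul t).tree.HomAt E z w ↔
    ∃ x, s.tree.HomAt E z x ∧ t.tree.HomAt E x w := by
  induction s generalizing z with
  | one => simp [mul, homAt_one]
  | branch a c s _ ih => simp [mul, homAt_branch, ih, and_assoc]
  | trunk a c ih =>
    simp only [mul, homAt_trunk, ih]
    exact ⟨fun ⟨x, h1, y, h2, h3⟩ => ⟨y, ⟨x, h1, h2⟩, h3⟩,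
      fun ⟨y, ⟨x, h1, h2⟩, h3⟩ => ⟨x, h1, y, h2, h3⟩⟩

theorem homAt_plus {s : TreeTerm A} : s.plus.tree.HomAt E z w ↔
    z = w ∧ ∃ x, s.tree.HomAt E z x := by
  induction s with
  | one => simp [plus, homAt_one]
  | branch a c s _ ih =>
    simp only [plus, homAt_branch, ih]
    exact ⟨fun ⟨h1, h2, x, h3⟩ => ⟨h2, x, h1, h3⟩, fun ⟨h2, x, h1, h3⟩ => ⟨h1, h2, x, h3⟩⟩
  | trunk a c ih =>
    simp only [plus, homAt_branch, homAt_trunk, homAt_one]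
    exact ⟨fun ⟨⟨x, h1, y, h2⟩, h⟩ => ⟨h, y, x, h1, h2⟩,
      fun ⟨h, y, x, h1, h2⟩ => ⟨⟨x, h1, y, h2⟩, h⟩⟩

end HomAt

theorem tree_mul (s t : TreeTerm A) : STree.HomEquiv (s.mul t).tree (s.tree.prod t.tree) :=
  STree.HomEquiv.of_homAt_iff fun _ _ _ _ => by rw [homAt_mul, STree.homAt_prod]

theorem tree_plus (t : TreeTerm A) : STree.HomEquiv t.plus.tree t.tree.plus :=
  STree.HomEquiv.of_homAt_iff fun _ _ _ _ => by rw [homAt_plus, STree.homAt_plus]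

/-! ### Evaluation of terms in left adequate monoids -/

variable {M : Type w} [MulOneClass M] (p : M → M) (χ : A → M)

/-- The value of a term under an assignment `χ` of elements of `M` to the letters. -/
def ev : TreeTerm A → M
  | one => 1
  | branch a c t => p (χ a * c.ev) * t.ev
  | trunk a c => χ a * c.ev

variable {p} (hM : IsLeftAdequateMonoid M p)

include hM in
theorem ev_mul (s t : TreeTerm A) : (s.mul t).ev p χ = s.ev p χ * t.ev p χ := by
  induction s with
  | one => simp [mul, ev]
  | branch a c s _ ih => simp only [mul, ev, ih, hM.assoc]
  | trunk a c ih => simp only [mul, ev, ih, hM.assoc]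

include hM in
theorem ev_plus (s : TreeTerm A) : s.plus.ev p χ = p (s.ev p χ) := by
  induction s with
  | one => simp [plus, ev, hM.proj_one]
  | branch a c s _ ih => simp only [plus, ev, ih, hM.proj_proj_mul]
  | trunk a c ih => simp only [plus, ev, mul_one]

/-! ### Homomorphically equivalent terms have the same value -/

variable (p) in
/-- The digraph which detects the values of terms. A vertex consists of a projection `e` and of
the record of a walk so far. There is an edge labelled `a` from `e` to `f` if `e ≤ (a f)⁺`, where
`e ≤ g` means `e * g = e`; the pair `(a, f)` is added to the record. -/
def RecordEdge (x : M × List (A × M)) (a : A) (y : M × List (A × M)) : Prop :=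
  p x.1 = x.1 ∧ p y.1 = y.1 ∧ x.1 * p (χ a * y.1) = x.1 ∧ y.2 = x.2 ++ [(a, y.1)]

variable (p) in
/-- The labels of the edges on the trunk of a term, each paired with the projection of the value
of the part of the tree that lies behind the edge. -/
def trunkRecord : TreeTerm A → List (A × M)
  | one => []
  | branch _ _ t => t.trunkRecord
  | trunk a c => (a, p (c.ev p χ)) :: c.trunkRecord

/-- The product `a₁ e₁ a₂ e₂ ⋯ aₙ eₙ` read off from a record. -/
def recordProd : List (A × M) → M
  | [] => 1
  | (a, e) :: l => χ a * e * recordProd l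

include hM in
/-- The value of a term is determined by its projection and its record. -/
theorem proj_ev_mul_recordProd (t : TreeTerm A) :
    p (t.ev p χ) * recordProd χ (t.trunkRecord p χ) = t.ev p χ := by
  induction t with
  | one => simp [ev, trunkRecord, recordProd, hM.proj_one]
  | branch a c t _ ih => rw [trunkRecord, ev, hM.proj_proj_mul, hM.assoc, ih]
  | trunk a c ih => rw [trunkRecord, recordProd, hM.assoc (χ a), ih, ev, hM.proj_mul_self]

include hM in
/-- The walk along the projections of the values is a map into the digraph of records. -/
theorem homAt_recordEdge (t : TreeTerm A) {e : M} (l : List (A × M)) (he : p e = e)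
    (hle : e * p (t.ev p χ) = e) :
    ∃ f, t.tree.HomAt (RecordEdge p χ) (e, l) (f, l ++ t.trunkRecord p χ) := by
  induction t generalizing e l with
  | one => exact ⟨e, by simp [homAt_one, trunkRecord]⟩
  | branch a c t ihc iht =>
    simp only [ev, hM.proj_proj_mul] at hle
    have h1 : e * p (χ a * c.ev p χ) = e := hM.le_trans hle (by
      rw [hM.assoc, hM.proj_comm (t.ev p χ), ← hM.assoc, hM.proj_idem])
    have h2 : e * p (t.ev p χ) = e := hM.le_trans hle (by rw [hM.assoc, hM.proj_idem])
    obtain ⟨f, hf⟩ := iht l he h2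
    obtain ⟨g, hg⟩ := ihc (l ++ [(a, p (c.ev p χ))]) (hM.proj_proj (c.ev p χ)) (hM.proj_idem _)
    exact ⟨f, homAt_branch.2 ⟨⟨(p (c.ev p χ), l ++ [(a, p (c.ev p χ))]), ⟨he, hM.proj_proj _,
      by rw [hM.proj_mul_proj, h1], rfl⟩, _, hg⟩, hf⟩⟩
  | trunk a c ih =>
    obtain ⟨g, hg⟩ := ih (l ++ [(a, p (c.ev p χ))]) (hM.proj_proj (c.ev p χ)) (hM.proj_idem _)
    refine ⟨g, homAt_trunk.2 ⟨(p (c.ev p χ), l ++ [(a, p (c.ev p χ))]),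
      ⟨he, hM.proj_proj (c.ev p χ), ?_, rfl⟩, ?_⟩⟩
    · rw [hM.proj_mul_proj]
      exact hle
    · rw [trunkRecord]
      simpa using hg

include hM in
/-- Among all maps into the digraph of records, the walk along the projections of the values is
the largest. -/
theorem le_of_homAt_recordEdge (t : TreeTerm A) {e : M} {l : List (A × M)}
    {y : M × List (A × M)} (he : p e = e) (h : t.tree.HomAt (RecordEdge p χ) (e, l) y) :
    e * p (t.ev p χ) = e ∧ ∃ k, y.2 = l ++ k ∧
      List.Forall₂ (fun i j => i.1 = j.1 ∧ p i.2 = i.2 ∧ i.2 * j.2 = i.2) k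
        (t.trunkRecord p χ) := by
  -- the step along one edge labelled `a` to a subterm `c`
  have hstep : ∀ (a : A) (c : TreeTerm A) {e f : M}, p f = f → e * p (χ a * f) = e →
      f * p (c.ev p χ) = f → e * p (χ a * c.ev p χ) = e := by
    intro a c e f hf h1 h2
    refine hM.le_trans h1 ?_
    have := hM.proj_mul_mono hf (hM.proj_proj (c.ev p χ)) h2 (χ a)
    rwa [hM.proj_mul_proj] at this
  induction t generalizing e l y with
  | one =>
    obtain rfl := homAt_one.1 h
    exact ⟨by simp [ev, hM.proj_one], [], by simp, List.Forall₂.nil⟩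
  | branch a c t ihc iht =>
    obtain ⟨⟨⟨f, m⟩, ⟨-, h2, h3, -⟩, ⟨g, n⟩, h5⟩, h6⟩ := homAt_branch.1 h
    obtain ⟨k1, k2⟩ := iht he h6
    refine ⟨?_, k2⟩
    rw [ev, hM.proj_proj_mul, ← hM.assoc, hstep a c h2 h3 (ihc h2 h5).1, k1]
  | trunk a c ih =>
    obtain ⟨⟨f, m⟩, ⟨-, h2, h3, hm⟩, h5⟩ := homAt_trunk.1 h
    obtain rfl : m = l ++ [(a, f)] := hm
    obtain ⟨k1, k, hk, k2⟩ := ih h2 h5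
    exact ⟨hstep a c h2 h3 k1, (a, f) :: k, by simpa using hk,
      List.Forall₂.cons ⟨rfl, h2, k1⟩ k2⟩

include hM in
/-- Terms describing homomorphically equivalent trees have the same value in every left adequate
monoid. -/
theorem ev_eq_of_homEquiv {s t : TreeTerm A} (h : STree.HomEquiv s.tree t.tree) :
    s.ev p χ = t.ev p χ := by
  have key : ∀ {s t : TreeTerm A}, STree.HomEquiv s.tree t.tree →
      p (s.ev p χ) * p (t.ev p χ) = p (s.ev p χ) ∧
      List.Forall₂ (fun i j => i.1 = j.1 ∧ p i.2 = i.2 ∧ i.2 * j.2 = i.2) (s.trunkRecord p χ)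
        (t.trunkRecord p χ) := by
    intro s t h
    obtain ⟨f, hf⟩ := s.homAt_recordEdge χ hM [] (hM.proj_proj _) (hM.proj_idem (s.ev p χ))
    obtain ⟨h1, k, hk, h2⟩ := t.le_of_homAt_recordEdge χ hM (hM.proj_proj _) (h.homAt_iff.1 hf)
    obtain rfl : s.trunkRecord p χ = k := by simpa using hk
    exact ⟨h1, h2⟩
  have hanti : ∀ {k l : List (A × M)},
      List.Forall₂ (fun i j => i.1 = j.1 ∧ p i.2 = i.2 ∧ i.2 * j.2 = i.2) k l →
      List.Forall₂ (fun i j => i.1 = j.1 ∧ p i.2 = i.2 ∧ i.2 * j.2 = i.2) l k → k = l := by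
    intro k l h h'
    induction h with
    | nil => rfl
    | @cons i j k l hij _ ih =>
      obtain ⟨hji, h'⟩ := List.forall₂_cons.1 h'
      have : i.2 = j.2 := by
        rw [← hij.2.2, ← hij.2.1, ← hji.2.1, hM.proj_comm, hji.2.1, hij.2.1, hji.2.2]
      rw [ih h', Prod.ext hij.1 this]
  obtain ⟨h1, h2⟩ := key h
  obtain ⟨k1, k2⟩ := key h.symm
  rw [← s.proj_ev_mul_recordProd χ hM, ← t.proj_ev_mul_recordProd χ hM, hanti h2 k2, ← h1,
    hM.proj_comm, k1]

end TreeTerm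

namespace STree

variable {A : Type u}

/-! ### Every left adequate tree is described by a term -/

/-- A relation between the vertices of two trees is a simulation if every edge that leaves a vertex
can be followed from the related vertices. -/
def IsSimulation (X Y : STree A) (R : X.V → Y.V → Prop) : Prop :=
  ∀ p a q y, R p y → X.Edge p a q → ∃ z, Y.Edge y a z ∧ R q z

/-- Some simulation relates the two vertices; equivalently, when `X` is left adequate, the part of
`X` which can be reached from `p` can be mapped to `Y` so that `p` goes to `y`. -/
def Simulates (X Y : STree A) (p : X.V) (y : Y.V) : Prop :=
  ∃ R, IsSimulation X Y R ∧ R p y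

theorem isSimulation_simulates (X Y : STree A) : IsSimulation X Y (Simulates X Y) := by
  rintro p a q y ⟨R, hR, hpy⟩ h
  obtain ⟨z, hz, hqz⟩ := hR p a q y hpy h
  exact ⟨z, hz, R, hR, hqz⟩

theorem simulates_of_forall_edge {X Y : STree A} {p : X.V} {y : Y.V}
    (h : ∀ a q, X.Edge p a q → ∃ z, Y.Edge y a z ∧ Simulates X Y q z) : Simulates X Y p y := by
  refine ⟨fun r x => (r = p ∧ x = y) ∨ Simulates X Y r x, ?_, Or.inl ⟨rfl, rfl⟩⟩
  rintro r a q x (⟨rfl, rfl⟩ | hr) he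
  · obtain ⟨z, hz, hqz⟩ := h a q he
    exact ⟨z, hz, Or.inr hqz⟩
  · obtain ⟨z, hz, hqz⟩ := isSimulation_simulates X Y r a q x hr he
    exact ⟨z, hz, Or.inr hqz⟩

end STree

namespace TreeTerm

variable {A : Type u}

/-- The term with the given list of branches at the start vertex, and no trunk. -/
def branches : List (A × TreeTerm A) → TreeTerm A
  | [] => one
  | x :: l => branch x.1 x.2 (branches l)

theorem homAt_branches {W : Type v} {E : W → A → W → Prop} {z w : W}
    {l : List (A × TreeTerm A)} : (branches l).tree.HomAt E z w ↔
      z = w ∧ ∀ x ∈ l, ∃ y, E z x.1 y ∧ ∃ y', x.2.tree.HomAt E y y' := by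
  induction l with
  | nil => simp [branches, homAt_one]
  | cons x l ih =>
    simp only [branches, homAt_branch, ih, List.forall_mem_cons]
    tauto

/-- The part of a left adequate tree above a vertex `v`, with start and end vertex `v`, is described
by a term. -/
theorem exists_describes_above {X : STree A} (hX : X.IsLeftAdequate) (v : X.V) :
    ∃ t : TreeTerm A, t.tree.HomAt X.Edge v v ∧ ∀ (Y : STree A) (z w : Y.V),
      t.tree.HomAt Y.Edge z w → z = w ∧ STree.Simulates X Y v z := by
  have := X.finite
  obtain ⟨d, -, hd⟩ := hX.exists_depth
  obtain ⟨N, hN⟩ := (Set.finite_range d).bddAbove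
  replace hN : ∀ p, d p ≤ N := fun p => hN ⟨p, rfl⟩
  induction hn : N - d v using Nat.strong_induction_on generalizing v with
  | _ n ih =>
    have hnext : ∀ q, ∃ t : TreeTerm A, X.Step v q → t.tree.HomAt X.Edge q q ∧
        ∀ (Y : STree A) (z w : Y.V), t.tree.HomAt Y.Edge z w →
          z = w ∧ STree.Simulates X Y q z := by
      intro q
      by_cases h : X.Step v q
      · have h1 := hd h
        have h2 := hN q
        obtain ⟨t, ht⟩ := ih (N - d q) (by omega) q rfl
        exact ⟨t, fun _ => ht⟩
      · exact ⟨one, fun k => (h k).elim⟩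
    choose t ht using hnext
    have hfin : {x : A × X.V | X.Edge v x.1 x.2}.Finite := by
      refine Set.Finite.of_finite_image (Set.toFinite (Prod.snd '' _)) ?_
      rintro ⟨a, p⟩ hp ⟨b, q⟩ hq (rfl : p = q)
      exact congrArg (·, p) (X.edge_label hp hq)
    have hmem : ∀ {E : (A × TreeTerm A) → Prop},
        (∀ x ∈ hfin.toFinset.toList.map (fun x => (x.1, t x.2)), E x) ↔
          ∀ a q, X.Edge v a q → E (a, t q) := by
      intro E
      simp only [List.forall_mem_map, Finset.mem_toList, Set.Finite.mem_toFinset, Prod.forall,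
        Set.mem_ofPred_eq]
    refine ⟨branches (hfin.toFinset.toList.map fun x => (x.1, t x.2)), ?_, ?_⟩
    · rw [homAt_branches, hmem]
      exact ⟨rfl, fun a q h => ⟨q, h, q, (ht q ⟨a, h⟩).1⟩⟩
    · intro Y z w h
      rw [homAt_branches, hmem] at h
      refine ⟨h.1, STree.simulates_of_forall_edge fun a q hq => ?_⟩
      obtain ⟨y, hy, y', hy'⟩ := h.2 a q hq
      exact ⟨y, hy, ((ht q ⟨a, hq⟩).2 Y y y' hy').2⟩

/-- The part of a left adequate tree above a vertex `v` on the trunk, with start vertex `v`, is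
described by a term: the branches at `v`, among which the trunk edge may be repeated, followed by
the trunk edge and a term for the rest. -/
theorem exists_describes_above_trunk {X : STree A} (hX : X.IsLeftAdequate) {v : X.V}
    (hv : X.Path v X.finish) :
    ∃ t : TreeTerm A, t.tree.HomAt X.Edge v X.finish ∧ ∀ (Y : STree A) (z w : Y.V),
      t.tree.HomAt Y.Edge z w →
        ∃ R, STree.IsSimulation X Y R ∧ R v z ∧ ∀ y, R X.finish y → y = w := by
  induction hv using Relation.ReflTransGen.head_induction_on with
  | refl =>
    obtain ⟨t, h1, h2⟩ := exists_describes_above hX X.finish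
    refine ⟨t, h1, fun Y z w h => ?_⟩
    obtain ⟨rfl, h3⟩ := h2 Y z w h
    -- off the trunk any related pair is allowed, on the trunk only the pair of the end vertices
    refine ⟨fun p y => (p = X.finish ∧ y = z) ∨ (STree.Simulates X Y p y ∧ ¬ X.Path p X.finish),
      ?_, Or.inl ⟨rfl, rfl⟩, ?_⟩
    · rintro p a q y (⟨rfl, rfl⟩ | ⟨h, hp⟩) he
      · obtain ⟨x, hx, hqx⟩ := STree.isSimulation_simulates X Y _ a q _ h3 he
        exact ⟨x, hx, Or.inr ⟨hqx, STree.not_path_of_step ⟨a, he⟩⟩⟩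
      · obtain ⟨x, hx, hqx⟩ := STree.isSimulation_simulates X Y _ a q _ h he
        exact ⟨x, hx, Or.inr ⟨hqx, fun hq => hp (Relation.ReflTransGen.head ⟨a, he⟩ hq)⟩⟩
    · rintro y (⟨-, rfl⟩ | ⟨-, h⟩)
      · rfl
      · exact (h Relation.ReflTransGen.refl).elim
  | @head v c hvc hc ih =>
    obtain ⟨s, hs1, hs2⟩ := exists_describes_above hX v
    obtain ⟨t, ht1, ht2⟩ := ih
    obtain ⟨b, hb⟩ := hvc
    -- `s` already contains the trunk edge as a branch, which does no harm up to equivalence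
    refine ⟨s.mul (trunk b t), ?_, fun Y z w h => ?_⟩
    · exact homAt_mul.2 ⟨v, hs1, homAt_trunk.2 ⟨c, hb, ht1⟩⟩
    · obtain ⟨x, hzx, h⟩ := homAt_mul.1 h
      obtain ⟨rfl, h3⟩ := hs2 Y z x hzx
      obtain ⟨x, hx, h⟩ := homAt_trunk.1 h
      obtain ⟨R, hR, hcx, hRw⟩ := ht2 Y x w h
      refine ⟨fun p y => (p = v ∧ y = z) ∨ R p y ∨
        (STree.Simulates X Y p y ∧ ¬ X.Path p X.finish), ?_, Or.inl ⟨rfl, rfl⟩, ?_⟩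
      · rintro p a q y (⟨rfl, rfl⟩ | h | ⟨h, hp⟩) he
        · by_cases hq : X.Path q X.finish
          · obtain rfl := hX.step_unique_of_path ⟨a, he⟩ ⟨b, hb⟩ hq hc
            obtain rfl := X.edge_label he hb
            exact ⟨x, hx, Or.inr (Or.inl hcx)⟩
          · obtain ⟨x', hx', hqx⟩ := STree.isSimulation_simulates X Y _ a q _ h3 he
            exact ⟨x', hx', Or.inr (Or.inr ⟨hqx, hq⟩)⟩
        · obtain ⟨x', hx', hqx⟩ := hR p a q y h he
          exact ⟨x', hx', Or.inr (Or.inl hqx)⟩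
        · obtain ⟨x', hx', hqx⟩ := STree.isSimulation_simulates X Y _ a q _ h he
          exact ⟨x', hx', Or.inr (Or.inr
            ⟨hqx, fun hq => hp (Relation.ReflTransGen.head ⟨a, he⟩ hq)⟩)⟩
      · rintro y (⟨rfl, -⟩ | h | ⟨-, h⟩)
        · exact (STree.not_path_of_step ⟨b, hb⟩ hc).elim
        · exact hRw y h
        · exact (h Relation.ReflTransGen.refl).elim

theorem exists_tree_homEquiv {X : STree A} (hX : X.IsLeftAdequate) :
    ∃ t : TreeTerm A, STree.HomEquiv t.tree X := by
  obtain ⟨t, h1, h2⟩ := exists_describes_above_trunk hX X.path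
  obtain ⟨R, hR, hstart, hfinish⟩ := h2 _ _ _
    (STree.homAt_iff_nonempty_hom.2 (STree.HomEquiv.refl t.tree).1)
  exact ⟨t, STree.homAt_iff_nonempty_hom.1 h1,
    hX.nonempty_hom_of_simulation hstart hR hfinish⟩

end TreeTerm

/-! ### Algebras of left adequate trees -/

/-- The unary operation of a `(2,1)`-algebra, extended to the algebra with an identity adjoined. -/
def unaryOne {S : Type w} [Algebra21 S] : WithOne S → WithOne S :=
  WithOne.recOneCoe 1 fun x => (Algebra21.unary x : S)

theorem IsLeftAdequate.isLeftAdequateMonoid {S : Type w} [Algebra21 S] (h : IsLeftAdequate S) :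
    IsLeftAdequateMonoid (WithOne S) unaryOne where
  assoc x y z := by
    induction x with
    | one => simp only [one_mul]
    | coe x =>
      induction y with
      | one => simp only [one_mul, mul_one]
      | coe y =>
        induction z with
        | one => simp only [mul_one]
        | coe z => exact congrArg WithOne.coe (h.mul_assoc x y z)
  proj_idem x := by
    induction x with
    | one => exact one_mul 1
    | coe x => exact congrArg WithOne.coe (h.unary_idem x)
  proj_comm x y := by
    induction x with
    | one => exact (one_mul _).trans (mul_one _).symm
    | coe x =>
      induction y with
      | one => exact (mul_one _).trans (one_mul _).symm
      | coe y =>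
        exact congrArg WithOne.coe (h.idem_comm _ _ (h.unary_idem x) (h.unary_idem y))
  proj_rStar x a b := by
    induction x with
    | one => exact Iff.rfl
    | coe x => exact h.unary_rStar x a b

/-- The algebra `F` is an algebra of left adequate `A`-trees up to homomorphic equivalence: the
element `x` is the class of the non-trivial tree `rep x`, the operations are induced by gluing and
by moving the end vertex to the start vertex, and `b a` is the class of the base tree of `a`. -/
structure IsTreeModel {A : Type u} {F : Type v} [Algebra21 F] (rep : F → STree A) (b : A → F) :
    Prop where
  isLeftAdequate : ∀ x, (rep x).IsLeftAdequate
  isNontrivial : ∀ x, (rep x).IsNontrivial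
  eq_of_homEquiv : ∀ {x y}, STree.HomEquiv (rep x) (rep y) → x = y
  rep_mul : ∀ x y, STree.HomEquiv (rep (x * y)) ((rep x).prod (rep y))
  rep_unary : ∀ x, STree.HomEquiv (rep (Algebra21.unary x)) (rep x).plus
  rep_base : ∀ a, STree.HomEquiv (rep (b a)) (STree.base a)

namespace STree

variable {A : Type u}

/-- If `X × X` maps to `X`, the start and the end vertex of `X` coincide, because the directed walk
between them would have to be twice as long as it is. -/
theorem start_eq_finish_of_hom {X : STree A} (f : Hom (X.prod X) X) : X.start = X.finish := by
  obtain ⟨m, h1, h2⟩ := homAt_prod.1 (homAt_iff_nonempty_hom.2 ⟨f⟩)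
  obtain ⟨n, hn⟩ := exists_dWalk X.path
  have := ((h1.dWalk hn).trans (h2.dWalk hn)).length_unique hn
  obtain rfl : n = 0 := by omega
  exact hn

/-- A morphism from `P × X` to `Q × X` takes the vertex at which `P` and `X` are glued to the one
at which `Q` and `X` are glued, because both are the starts of directed walks of the same length
to the end vertex. So it is still a morphism after `X` is replaced by `X⁽⁺⁾`. -/
theorem nonempty_hom_prod_plus {P Q X : STree A} (hQ : Q.IsLeftAdequate)
    (hX : X.IsLeftAdequate) (f : Hom (P.prod X) (Q.prod X)) :
    Nonempty (Hom (P.prod X.plus) (Q.prod X.plus)) := by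
  obtain ⟨m, h1, h2⟩ := homAt_prod.1 (homAt_iff_nonempty_hom.2 ⟨f⟩)
  have h3 : X.HomAt (Q.prod X).Edge ⟨(Q.finish, X.start), Or.inl rfl⟩ (Q.prod X).finish :=
    ⟨fun p => ⟨(Q.finish, p), Or.inl rfl⟩, fun p a q h => Or.inr ⟨h, rfl, rfl⟩, rfl, rfl⟩
  obtain ⟨n, hn⟩ := exists_dWalk X.path
  obtain rfl := (hQ.prod hX).dWalk_unique (h2.dWalk hn) (h3.dWalk hn)
  rw [← homAt_iff_nonempty_hom]
  exact homAt_prod.2 ⟨_, h1, homAt_plus.2 ⟨rfl, _, h3⟩⟩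

end STree

namespace IsTreeModel

variable {A : Type u} {F : Type v} [Algebra21 F] {rep : F → STree A} {b : A → F}

/-- The representing trees of the elements of the algebra with an identity adjoined; the identity
is represented by the trivial tree. -/
def repOne (rep : F → STree A) : WithOne F → STree A :=
  WithOne.recOneCoe (STree.trivial A) rep

variable (h : IsTreeModel rep b)
include h

theorem repOne_isLeftAdequate (x : WithOne F) : (repOne rep x).IsLeftAdequate := by
  induction x with
  | one => exact STree.trivial_isLeftAdequate
  | coe x => exact h.isLeftAdequate x

theorem repOne_mul (x y : WithOne F) :
    STree.HomEquiv (repOne rep (x * y)) ((repOne rep x).prod (repOne rep y)) := by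
  induction x with
  | one => rw [one_mul]; exact (STree.HomEquiv.trivial_prod _).symm
  | coe x =>
    induction y with
    | one => rw [mul_one]; exact (STree.HomEquiv.prod_trivial _).symm
    | coe y => exact h.rep_mul x y

theorem repOne_unaryOne (x : WithOne F) :
    STree.HomEquiv (repOne rep (unaryOne x)) (repOne rep x).plus := by
  induction x with
  | one => exact STree.HomEquiv.refl (STree.trivial A)
  | coe x => exact h.rep_unary x

theorem repOne_eq_iff {x y : WithOne F} :
    x = y ↔ STree.HomEquiv (repOne rep x) (repOne rep y) := by
  refine ⟨fun e => e ▸ STree.HomEquiv.refl _, fun e => ?_⟩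
  induction x with
  | one =>
    induction y with
    | one => rfl
    | coe y =>
      obtain ⟨-, ⟨f⟩⟩ := e
      exact (STree.not_isNontrivial_trivial ((h.isNontrivial y).of_hom f)).elim
  | coe x =>
    induction y with
    | one =>
      obtain ⟨⟨f⟩, -⟩ := e
      exact (STree.not_isNontrivial_trivial ((h.isNontrivial x).of_hom f)).elim
    | coe y => exact congrArg WithOne.coe (h.eq_of_homEquiv e)

theorem ext {x y : F} (hxy : ∀ (W : Type) (E : W → A → W → Prop) (z w : W),
    (rep x).HomAt E z w ↔ (rep y).HomAt E z w) : x = y :=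
  h.eq_of_homEquiv (STree.HomEquiv.of_homAt_iff hxy)

theorem homAt_mul {W : Type w} {E : W → A → W → Prop} {z w : W} {x y : F} :
    (rep (x * y)).HomAt E z w ↔ ∃ m, (rep x).HomAt E z m ∧ (rep y).HomAt E m w := by
  rw [(h.rep_mul x y).homAt_iff, STree.homAt_prod]

theorem homAt_unary {W : Type w} {E : W → A → W → Prop} {z w : W} {x : F} :
    (rep (Algebra21.unary x)).HomAt E z w ↔ z = w ∧ ∃ y, (rep x).HomAt E z y := by
  rw [(h.rep_unary x).homAt_iff, STree.homAt_plus]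

theorem eq_of_homAt_of_isIdempotentElem {x : F} (hx : IsIdempotentElem x) {W : Type w}
    {E : W → A → W → Prop} {z w : W} (hzw : (rep x).HomAt E z w) : z = w := by
  obtain ⟨-, ⟨f⟩⟩ := h.rep_mul x x
  rw [hx.eq] at f
  obtain ⟨g, -, rfl, rfl⟩ := hzw
  rw [STree.start_eq_finish_of_hom f]

theorem isLeftAdequate_algebra : IsLeftAdequate F where
  mul_assoc x y z := h.ext fun _ _ _ _ => by
    simp only [h.homAt_mul]
    exact ⟨fun ⟨m, ⟨n, h1, h2⟩, h3⟩ => ⟨n, h1, m, h2, h3⟩,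
      fun ⟨n, h1, m, h2, h3⟩ => ⟨m, ⟨n, h1, h2⟩, h3⟩⟩
  idem_comm e f he hf := h.ext fun W E z w => by
    have key : ∀ {e f : F}, IsIdempotentElem e → IsIdempotentElem f →
        (rep (e * f)).HomAt E z w → (rep (f * e)).HomAt E z w := by
      intro e f he hf hef
      obtain ⟨m, h1, h2⟩ := h.homAt_mul.1 hef
      obtain rfl := h.eq_of_homAt_of_isIdempotentElem he h1
      obtain rfl := h.eq_of_homAt_of_isIdempotentElem hf h2
      exact h.homAt_mul.2 ⟨_, h2, h1⟩
    exact ⟨key he hf, key hf he⟩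
  unary_idem x := h.ext fun _ _ _ _ => by
    simp only [h.homAt_mul, h.homAt_unary]
    constructor
    · rintro ⟨_, ⟨rfl, h1⟩, ⟨rfl, -⟩⟩
      exact ⟨rfl, h1⟩
    · rintro ⟨rfl, h1⟩
      exact ⟨_, ⟨rfl, h1⟩, ⟨rfl, h1⟩⟩
  unary_rStar x := by
    intro a c
    have hrep : ∀ y : WithOne F, STree.HomEquiv (repOne rep (y * (Algebra21.unary x : F)))
        ((repOne rep y).prod (rep x).plus) := fun y =>
      (h.repOne_mul y _).trans ((STree.HomEquiv.refl _).prod (h.rep_unary x))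
    constructor
    · intro hac
      rw [h.repOne_eq_iff] at hac ⊢
      obtain ⟨⟨f⟩, ⟨g⟩⟩ :=
        (h.repOne_mul a (x : F)).symm.trans (hac.trans (h.repOne_mul c (x : F)))
      refine (hrep a).trans (STree.HomEquiv.trans ?_ (hrep c).symm)
      exact ⟨STree.nonempty_hom_prod_plus (h.repOne_isLeftAdequate c) (h.isLeftAdequate x) f,
        STree.nonempty_hom_prod_plus (h.repOne_isLeftAdequate a) (h.isLeftAdequate x) g⟩
    · intro hac
      rw [h.repOne_eq_iff] at hac ⊢
      have hac' := (hrep a).symm.trans (hac.trans (hrep c))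
      have absorb : ∀ y : WithOne F, STree.HomEquiv (repOne rep (y * (x : F)))
          (((repOne rep y).prod (rep x).plus).prod (rep x)) := by
        intro y
        refine (h.repOne_mul y x).trans (STree.HomEquiv.of_homAt_iff fun W E z w => ?_)
        simp only [STree.homAt_prod, STree.homAt_plus]
        constructor
        · rintro ⟨m, h1, h2⟩
          exact ⟨m, ⟨m, h1, rfl, _, h2⟩, h2⟩
        · rintro ⟨m, ⟨_, h1, rfl, -⟩, h2⟩
          exact ⟨_, h1, h2⟩
      exact (absorb a).trans ((hac'.prod (STree.HomEquiv.refl _)).trans (absorb c).symm)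

/-! ### Freeness -/

/-- The value of a term under the assignment of the base trees to the letters is the class of the
tree which the term describes. -/
theorem repOne_ev (t : TreeTerm A) :
    STree.HomEquiv (repOne rep (t.ev unaryOne fun a => (b a : WithOne F))) t.tree := by
  have hedge : ∀ (a : A) {c : TreeTerm A},
      STree.HomEquiv (repOne rep (c.ev unaryOne fun a => (b a : WithOne F))) c.tree →
      STree.HomEquiv (repOne rep ((b a : WithOne F) * c.ev unaryOne fun a => (b a : WithOne F)))
        ((STree.base a).prod c.tree) := fun a c hc =>
    (h.repOne_mul _ _).trans ((h.rep_base a).prod hc)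
  induction t with
  | one => exact STree.HomEquiv.refl _
  | branch a c t ihc iht =>
    exact (h.repOne_mul _ _).trans (((h.repOne_unaryOne _).trans (hedge a ihc).plus).prod iht)
  | trunk a c ih => exact hedge a ih

end IsTreeModel

/-- The values of morphisms on the values of terms are determined by the images of the letters. -/
theorem IsMorphism.coe_map_of_ev {A : Type u} {F : Type v} {N : Type w} [Algebra21 F]
    [Algebra21 N] {φ : F → N} (hφ : IsMorphism φ) (b : A → F) (t : TreeTerm A) {x : F}
    (hx : (x : WithOne F) = t.ev unaryOne fun a => (b a : WithOne F)) :
    (φ x : WithOne N) = t.ev unaryOne fun a => (φ (b a) : WithOne N) := by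
  let Φ : WithOne F → WithOne N := WithOne.recOneCoe 1 fun x => (φ x : N)
  have hmul : ∀ x y, Φ (x * y) = Φ x * Φ y := by
    intro x y
    induction x with
    | one => rw [one_mul]; exact (one_mul _).symm
    | coe x =>
      induction y with
      | one => rw [mul_one]; exact (mul_one _).symm
      | coe y => exact congrArg WithOne.coe (hφ.map_mul x y)
  have hunary : ∀ x, Φ (unaryOne x) = unaryOne (Φ x) := by
    intro x
    induction x with
    | one => rfl
    | coe x => exact congrArg WithOne.coe (hφ.map_unary x)
  have key : ∀ t : TreeTerm A, Φ (t.ev unaryOne fun a => (b a : WithOne F)) =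
      t.ev unaryOne fun a => (φ (b a) : WithOne N) := by
    intro t
    induction t with
    | one => rfl
    | branch a c t ihc iht =>
      simp only [TreeTerm.ev, hmul, hunary, ihc, iht]
      rfl
    | trunk a c ih =>
      simp only [TreeTerm.ev, hmul, ih]
      rfl
  rw [← key, ← hx]
  rfl

/-- The value of a term which does not describe the trivial tree is not the adjoined identity. -/
theorem TreeTerm.exists_coe_eq_ev {A : Type u} {N : Type w} [Algebra21 N] (χ : A → N)
    {t : TreeTerm A} (ht : t.tree.IsNontrivial) :
    ∃ n : N, (n : WithOne N) = t.ev unaryOne fun a => (χ a : WithOne N) := by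
  have hcoe : ∀ (n : N) (y : WithOne N), ∃ m : N, (m : WithOne N) = n * y := by
    intro n y
    induction y with
    | one => exact ⟨n, (mul_one _).symm⟩
    | coe y => exact ⟨n * y, rfl⟩
  cases t with
  | one => exact (STree.not_isNontrivial_trivial ht).elim
  | branch a c t =>
    obtain ⟨m, hm⟩ := hcoe (χ a) (c.ev unaryOne fun a => (χ a : WithOne N))
    obtain ⟨n, hn⟩ := hcoe (Algebra21.unary m) (t.ev unaryOne fun a => (χ a : WithOne N))
    refine ⟨n, ?_⟩
    rw [hn, TreeTerm.ev, ← hm]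
    rfl
  | trunk a c => exact hcoe _ _

theorem IsTreeModel.isFreeLeftAdequateOn {A : Type u} {F : Type v} [Algebra21 F]
    {rep : F → STree A} {b : A → F} (h : IsTreeModel rep b) :
    IsFreeLeftAdequateOn.{v, w} F (Set.range b) where
  isLeftAdequate := h.isLeftAdequate_algebra
  existsUnique_extension := by
    intro N _ hN χ
    have hM := hN.isLeftAdequateMonoid
    let χ' : A → N := fun a => χ ⟨b a, a, rfl⟩
    let ev : TreeTerm A → WithOne N := fun t => t.ev unaryOne fun a => (χ' a : WithOne N)
    have hev : ∀ {s t : TreeTerm A}, STree.HomEquiv s.tree t.tree → ev s = ev t :=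
      fun hst => TreeTerm.ev_eq_of_homEquiv _ hM hst
    choose t ht using fun x => TreeTerm.exists_tree_homEquiv (h.isLeftAdequate x)
    choose φ hφ using fun x => TreeTerm.exists_coe_eq_ev χ' (t := t x)
      ((h.isNontrivial x).of_hom (ht x).2.some)
    refine ⟨φ, ⟨⟨fun x y => ?_, fun x => ?_⟩, ?_⟩, ?_⟩
    · have h1 : ev (t (x * y)) = ev ((t x).mul (t y)) :=
        hev ((ht _).trans ((h.rep_mul x y).trans
          (((ht x).prod (ht y)).symm.trans (TreeTerm.tree_mul _ _).symm)))
      have h2 : ev ((t x).mul (t y)) = ev (t x) * ev (t y) := TreeTerm.ev_mul _ hM _ _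
      apply WithOne.coe_injective
      rw [WithOne.coe_mul, hφ, hφ, hφ]
      exact h1.trans h2
    · have h1 : ev (t (Algebra21.unary x)) = ev (t x).plus :=
        hev ((ht _).trans ((h.rep_unary x).trans
          ((ht x).plus.symm.trans (TreeTerm.tree_plus _).symm)))
      have h2 : ev (t x).plus = unaryOne (ev (t x)) := TreeTerm.ev_plus _ hM _
      apply WithOne.coe_injective
      rw [hφ]
      refine h1.trans (h2.trans ?_)
      change unaryOne (TreeTerm.ev _ _ _) = _
      rw [← hφ]
      rfl
    · rintro ⟨_, a, rfl⟩
      have h1 : ev (t (b a)) = ev (TreeTerm.trunk a TreeTerm.one) :=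
        hev ((ht _).trans ((h.rep_base a).trans (STree.HomEquiv.prod_trivial _).symm))
      apply WithOne.coe_injective
      rw [hφ]
      exact h1.trans (mul_one _)
    · rintro ψ ⟨hψ, hψb⟩
      funext x
      have hx : (x : WithOne F) = (t x).ev unaryOne fun a => (b a : WithOne F) :=
        h.repOne_eq_iff.2 ((ht x).symm.trans (h.repOne_ev (t x)).symm)
      have hb : (fun a => (ψ (b a) : WithOne N)) = fun a => (χ' a : WithOne N) := by
        funext a
        exact congrArg WithOne.coe (hψb ⟨b a, a, rfl⟩)
      apply WithOne.coe_injective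
      rw [hφ, hψ.coe_map_of_ev b (t x) hx, hb]

/-! ### Isomorphism types of pruned trees -/

namespace UT1

variable {A : Type u}

theorem iso_of_mk_eq {X Y : STree A} (h : mk X = mk Y) : STree.Iso X Y :=
  Quotient.exact (s := STree.isoSetoid A) h

theorem homEquiv_of_mk_eq_pruning {X Y : STree A} (h : mk Y = (mk X).pruning) :
    STree.HomEquiv Y X := by
  obtain ⟨Z, hZ, -, hZX⟩ := pruning_mk X
  exact (STree.HomEquiv.of_iso (iso_of_mk_eq (h.trans hZ))).trans
    (STree.HomEquiv.of_isRetractOf hZX)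

end UT1

theorem STree.eq_of_iso_base {A : Type u} {a c : A} (h : STree.Iso (STree.base a) (STree.base c)) :
    a = c := by
  obtain ⟨f, hf, -, -⟩ := h
  exact ((hf false a true).1 ⟨rfl, rfl, rfl⟩).2.1

theorem LT.base_injective (A : Type u) : Function.Injective (LT.base : A → LT A) :=
  fun _ _ h => STree.eq_of_iso_base (UT1.iso_of_mk_eq (congrArg Subtype.val h))

theorem RT.base_injective (A : Type u) : Function.Injective (RT.base : A → RT A) :=
  fun _ _ h => STree.eq_of_iso_base (UT1.iso_of_mk_eq (congrArg Subtype.val h))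

theorem LT.exists_isTreeModel (A : Type u) :
    ∃ rep : LT A → STree A, IsTreeModel rep LT.base := by
  choose rep hmk hnt hpr hla using fun x : LT A => x.2
  refine ⟨rep, hla, hnt, fun {x y} h => ?_, fun x y => ?_, fun x => ?_, fun a => ?_⟩
  · apply Subtype.ext
    rw [← hmk x, ← hmk y]
    exact UT1.mk_eq ((hpr x).iso_of_homEquiv (hpr y) h)
  · apply UT1.homEquiv_of_mk_eq_pruning
    refine (hmk (x * y)).trans ?_
    change (x.1.prod y.1).pruning = _
    rw [← hmk x, ← hmk y]
    rfl
  · apply UT1.homEquiv_of_mk_eq_pruning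
    refine (hmk (Algebra21.unary x)).trans ?_
    change x.1.plus.pruning = _
    rw [← hmk x]
    rfl
  · exact STree.HomEquiv.of_iso (UT1.iso_of_mk_eq (hmk (LT.base a)))

/-! ### Reversal and right adequate trees -/

namespace STree

variable {A : Type u}

/-- The tree with all edges reversed, and with the start and the end vertex exchanged. -/
def rev (X : STree A) : STree A where
  V := X.V
  finite := X.finite
  Edge := fun p a q => X.Edge q a p
  start := X.finish
  finish := X.start
  edge_label := fun h k => X.edge_label h k
  edge_dir := fun h k => X.edge_dir h k
  isTree := by
    have h : SimpleGraph.fromRel (fun p q => ∃ a, X.Edge q a p) =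
        SimpleGraph.fromRel (fun p q => ∃ a, X.Edge p a q) := by
      ext p q
      simp only [SimpleGraph.fromRel_adj, or_comm]
    rw [h]
    exact X.isTree
  path := X.path.swap

theorem IsRightAdequate.rev {X : STree A} (hX : X.IsRightAdequate) : X.rev.IsLeftAdequate :=
  fun p => (hX p).swap

/-- Reversal turns morphisms into morphisms. -/
def Hom.rev {X Y : STree A} (f : Hom X Y) : Hom X.rev Y.rev :=
  ⟨f.toFun, fun h => f.map_edge h, f.map_finish, f.map_start⟩

theorem HomEquiv.rev {X Y : STree A} (h : HomEquiv X Y) : HomEquiv X.rev Y.rev :=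
  ⟨h.1.map Hom.rev, h.2.map Hom.rev⟩

theorem HomEquiv.of_rev {X Y : STree A} (h : HomEquiv X.rev Y.rev) : HomEquiv X Y :=
  HomEquiv.rev (X := X.rev) (Y := Y.rev) h

theorem HomEquiv.rev_prod (X Y : STree A) : HomEquiv (X.prod Y).rev (Y.rev.prod X.rev) :=
  ⟨⟨⟨fun p => ⟨(p.1.2, p.1.1), p.2.symm⟩, fun h => h.symm.imp (fun k => ⟨k.1, k.2.2, k.2.1⟩)
      (fun k => ⟨k.1, k.2.2, k.2.1⟩), rfl, rfl⟩⟩,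
    ⟨⟨fun p => ⟨(p.1.2, p.1.1), p.2.symm⟩, fun h => h.symm.imp (fun k => ⟨k.1, k.2.2, k.2.1⟩)
      (fun k => ⟨k.1, k.2.2, k.2.1⟩), rfl, rfl⟩⟩⟩

theorem HomEquiv.rev_base (a : A) : HomEquiv (base a).rev (base a) := by
  refine ⟨⟨⟨Bool.not, ?_, rfl, rfl⟩⟩, ⟨⟨Bool.not, ?_, rfl, rfl⟩⟩⟩
  · rintro p c q ⟨rfl, rfl, rfl⟩
    exact ⟨rfl, rfl, rfl⟩
  · rintro p c q ⟨rfl, rfl, rfl⟩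
    exact ⟨rfl, rfl, rfl⟩

end STree

/-- The opposite of a `(2,1)`-algebra, with the same unary operation. -/
instance {S : Type w} [Algebra21 S] : Algebra21 Sᵐᵒᵖ where
  unary x := MulOpposite.op (Algebra21.unary x.unop)

theorem RT.exists_isTreeModel (A : Type u) :
    ∃ rep : (RT A)ᵐᵒᵖ → STree A, IsTreeModel rep fun a => MulOpposite.op (RT.base a) := by
  choose rep hmk hnt hpr hra using fun x : RT A => x.2
  refine ⟨fun x => (rep x.unop).rev, fun x => (hra _).rev, fun x => hnt x.unop,
    fun {x y} h => ?_, fun x y => ?_, fun x => ?_, fun a => ?_⟩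
  · apply MulOpposite.unop_injective
    apply Subtype.ext
    rw [← hmk x.unop, ← hmk y.unop]
    exact UT1.mk_eq ((hpr _).iso_of_homEquiv (hpr _) h.of_rev)
  · refine STree.HomEquiv.trans (STree.HomEquiv.rev ?_) (STree.HomEquiv.rev_prod _ _)
    apply UT1.homEquiv_of_mk_eq_pruning
    refine (hmk (y.unop * x.unop)).trans ?_
    change (y.unop.1.prod x.unop.1).pruning = _
    rw [← hmk x.unop, ← hmk y.unop]
    rfl
  · refine STree.HomEquiv.rev (Y := (rep x.unop).star) ?_
    apply UT1.homEquiv_of_mk_eq_pruning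
    refine (hmk (Algebra21.unary x.unop)).trans ?_
    change x.unop.1.star.pruning = _
    rw [← hmk x.unop]
    rfl
  · exact (STree.HomEquiv.of_iso (UT1.iso_of_mk_eq (hmk (RT.base a)))).rev.trans
      (STree.HomEquiv.rev_base a)

/-- The canonical map from the opposite of `S`, with an identity adjoined, to `S` with an identity
adjoined; it reverses products. -/
def unopOne {S : Type w} : WithOne Sᵐᵒᵖ → WithOne S :=
  WithOne.recOneCoe 1 fun x => (x.unop : S)

theorem unopOne_injective {S : Type w} :
    Function.Injective (unopOne : WithOne Sᵐᵒᵖ → WithOne S) := by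
  intro x y h
  induction x with
  | one =>
    induction y with
    | one => rfl
    | coe y => exact (WithOne.one_ne_coe h).elim
  | coe x =>
    induction y with
    | one => exact (WithOne.coe_ne_one h).elim
    | coe y => exact congrArg WithOne.coe (MulOpposite.unop_injective (WithOne.coe_injective h))

theorem unopOne_surjective {S : Type w} :
    Function.Surjective (unopOne : WithOne Sᵐᵒᵖ → WithOne S) := by
  intro x
  induction x with
  | one => exact ⟨1, rfl⟩
  | coe x => exact ⟨(MulOpposite.op x : Sᵐᵒᵖ), rfl⟩

theorem unopOne_mul {S : Type w} [Mul S] (x y : WithOne Sᵐᵒᵖ) :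
    unopOne (x * y) = unopOne y * unopOne x := by
  induction x with
  | one => rw [one_mul]; exact (mul_one _).symm
  | coe x =>
    induction y with
    | one => rw [mul_one]; exact (one_mul _).symm
    | coe y => rfl

theorem rStar_op_iff {S : Type w} [Mul S] {a c : Sᵐᵒᵖ} : RStar a c ↔ LStar a.unop c.unop := by
  have hmul : ∀ (x y : WithOne Sᵐᵒᵖ) (d : Sᵐᵒᵖ), x * (d : WithOne Sᵐᵒᵖ) = y * (d : WithOne Sᵐᵒᵖ) ↔
      (d.unop : WithOne S) * unopOne x = (d.unop : WithOne S) * unopOne y := by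
    intro x y d
    rw [← unopOne_injective.eq_iff, unopOne_mul, unopOne_mul]
    rfl
  simp only [RStar, LStar, hmul]
  exact (unopOne_surjective.forall₂ (p := fun x y =>
    (a.unop : WithOne S) * x = (a.unop : WithOne S) * y ↔
      (c.unop : WithOne S) * x = (c.unop : WithOne S) * y)).symm

theorem IsRightAdequate.op {S : Type w} [Algebra21 S] (h : IsRightAdequate S) :
    IsLeftAdequate Sᵐᵒᵖ where
  mul_assoc x y z := MulOpposite.unop_injective (h.mul_assoc z.unop y.unop x.unop).symm
  idem_comm _ _ he hf := MulOpposite.unop_injective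
    (h.idem_comm _ _ (congrArg MulOpposite.unop hf) (congrArg MulOpposite.unop he))
  unary_idem x := congrArg MulOpposite.op (h.unary_idem x.unop)
  unary_rStar x := rStar_op_iff.2 (h.unary_lStar x.unop)

theorem IsLeftAdequate.of_op {S : Type w} [Algebra21 S] (h : IsLeftAdequate Sᵐᵒᵖ) :
    IsRightAdequate S where
  mul_assoc x y z := congrArg MulOpposite.unop
    (h.mul_assoc (MulOpposite.op z) (MulOpposite.op y) (MulOpposite.op x)).symm
  idem_comm _ _ he hf := congrArg MulOpposite.unop
    (h.idem_comm _ _ (congrArg MulOpposite.op hf) (congrArg MulOpposite.op he))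
  unary_idem x := congrArg MulOpposite.unop (h.unary_idem (MulOpposite.op x))
  unary_lStar x := rStar_op_iff.1 (h.unary_rStar (MulOpposite.op x))

theorem IsFreeLeftAdequateOn.of_op {F : Type v} [Algebra21 F] {A : Type u} {b : A → F}
    (h : IsFreeLeftAdequateOn.{v, w} Fᵐᵒᵖ (Set.range fun a => MulOpposite.op (b a))) :
    IsFreeRightAdequateOn.{v, w} F (Set.range b) where
  isRightAdequate := h.isLeftAdequate.of_op
  existsUnique_extension := by
    intro N _ hN χ
    obtain ⟨φ, ⟨hφ, hφb⟩, huniq⟩ := h.existsUnique_extension Nᵐᵒᵖ hN.op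
      fun x => MulOpposite.op (χ ⟨x.1.unop, x.2.imp fun a ha => congrArg MulOpposite.unop ha⟩)
    refine ⟨fun x => (φ (MulOpposite.op x)).unop,
      ⟨⟨fun x y => congrArg MulOpposite.unop (hφ.map_mul (MulOpposite.op y) (MulOpposite.op x)),
        fun x => congrArg MulOpposite.unop (hφ.map_unary (MulOpposite.op x))⟩, ?_⟩, ?_⟩
    · rintro ⟨_, a, rfl⟩
      exact congrArg MulOpposite.unop (hφb ⟨MulOpposite.op (b a), a, rfl⟩)
    · rintro ψ ⟨hψ, hψb⟩
      have := huniq (fun x => MulOpposite.op (ψ x.unop))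
        ⟨⟨fun x y => congrArg MulOpposite.op (hψ.map_mul y.unop x.unop),
          fun x => congrArg MulOpposite.op (hψ.map_unary x.unop)⟩, by
          rintro ⟨_, a, rfl⟩
          exact congrArg MulOpposite.op (hψb ⟨b a, a, rfl⟩)⟩
      funext x
      exact congrArg MulOpposite.unop (congrFun this (MulOpposite.op x))

end AdequateTrees

/-- For every set `A`, the base trees are in bijection with `A`, and `LT(A)` (respectively `RT(A)`)
is a free left (respectively right) adequate semigroup, free on the set of base trees. -/
theorem mainTheorem2 (A : Type u) :
    (Function.Injective (AdequateTrees.LT.base : A → AdequateTrees.LT A) ∧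
      AdequateTrees.IsFreeLeftAdequateOn.{max 1 u, w} (AdequateTrees.LT A)
        (Set.range AdequateTrees.LT.base)) ∧
    (Function.Injective (AdequateTrees.RT.base : A → AdequateTrees.RT A) ∧
      AdequateTrees.IsFreeRightAdequateOn.{max 1 u, w} (AdequateTrees.RT A)
        (Set.range AdequateTrees.RT.base)) := by
  obtain ⟨_, hL⟩ := AdequateTrees.LT.exists_isTreeModel A
  obtain ⟨_, hR⟩ := AdequateTrees.RT.exists_isTreeModel A
  exact ⟨⟨AdequateTrees.LT.base_injective A, hL.isFreeLeftAdequateOn⟩,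
    ⟨AdequateTrees.RT.base_injective A, hR.isFreeLeftAdequateOn.of_op⟩⟩
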